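/- Let $D$ be an alternating diagram (in the plane) of an unoriented framed link, with the blackboard framing, and let $G$ be its Tait graph: colour $D$ chessboard-wise so that at each crossing the shaded corners are the two that are separated by the $A$-smoothing; the vertices of $G$ are the shaded faces, and each crossing is an edge joining the shaded faces at its two shaded corners. (If $D$ is disconnected, $G$ is the disjoint union of the Tait graphs of its connected pieces; a component without crossings gives an isolated vertex.) $G$ is a finite multigraph, possibly with loops; $V$ and $E$ are its numbers of vertices and edges, and $\ell$ is the length of a shortest cycle of $G$ (a loop has length $1$, a pair of parallel edges length $2$; $\ell=\infty$ if $G$ is a forest). *Graph cohomology.* Let $\mathcal A=\mathbb Z[x]/(x^2)$ with $\deg x=1$, and order the edges of $G$. $C^{i,j}(G)$ is the free abelian group on pairs $(s,c)$, where $s$ is a set of $i$ edges and $c$ assigns $1$ or $x$ to each component of the spanning subgraph $[G:s]$, with exactly $j$ labels $x$. Thus $\bigoplus_jC^{i,j}(G)=\bigoplus_{|s|=i}\mathcal A^{\otimes\,\mathrm{comp}[G:s]}$. The differential $C^{i,j}\to C^{i+1,j}$ is $\sum_{e\notin s}(-1)^{\#\{f\in s:\,f<e\}}d_e$, where $d_e$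 multiplies the labels of the two components joined by $e$ (in $\mathcal A$), and is the identity on labels if $e$ joins a component to itself. Its cohomology is $H^{i,j}_{Graph}(G)$. *Viro's homology.* An enhanced state $S$ of $D$ is a choice of a $0$-marker ($A$-smoothing) or $1$-marker ($A^{-1}$-smoothing) at each crossing and of a label $1$ or $x$ on each resulting circle. Put $\sigma(S)=\#\{0\text{-markers}\}-\#\{1\text{-markers}\}$, $p(S)=\#\{\text{circles labelled }1\}-\#\{\text{circles labelled }x\}$ and $q(S)=\sigma(S)-2p(S)$. $C_{p,q}(D)$ is the free abelian group on the enhanced states with $p(S)=p$, $q(S)=q$. The differential $C_{p,q}(D)\to C_{p-1,q}(D)$ is the sum, with the same signs as above for the induced order of the crossings, over all ways of changing one $0$-marker to a $1$-marker, with $1\cdot1=1$, $1\cdot x=x\cdot 1=x$, $x\cdot x=0$ when two circles merge and $1\mapsto1\otimes x+x\otimes1$, $x\mapsto x\otimes x$ when a circle splits. Its homology is $H_{p,q}(D)$. Grouping the enhanced states by $(a,b)=(\sigma(S),q(S))$ instead gives the same homology with different indices, denoted $H'_{a,b}(D)$. **Theorem.** Let $i,j\ge0$ and put $p=V-i-2j$,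 $q=E-2V+4j$. 1. If $i<\ell-1$, then $H^{i,j}_{Graph}(G)\cong H_{p,q}(D)$, and also $H^{i,j}_{Graph}(G)\cong H'_{a,b}(D)$ with $a=E-2i$, $b=E-2V+4j$. 2. If $i=\ell-1$, then $\mathrm{Tor}\,H^{i,j}_{Graph}(G)\cong \mathrm{Tor}\,H_{p,q}(D)$. -/

import Mathlib

/-! ### Homology of a three-term piece spanned by states -/

/-- The free abelian group on those states `x` that satisfy `P`
(only used when there are finitely many states). -/
abbrev StateChain {S : Type*} (P : S → Prop) : Type _ := {x : S // P x} → ℤ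

/-- The homomorphism `StateChain P → StateChain Q` sending a basis state `x` to
`∑ y, inc x y • y`, the sum being over the states `y` that satisfy `Q`. -/
noncomputable def stateMap {S : Type*} [Finite S] (inc : S → S → ℤ) (P Q : S → Prop) :
    StateChain P →ₗ[ℤ] StateChain Q :=
  letI : Fintype {x : S // P x} := Fintype.ofFinite _
  Matrix.mulVecLin (Matrix.of fun (y : {x : S // Q x}) (x : {x : S // P x}) => inc x y)

/-- Homology at the middle term of `StateChain P → StateChain Q → StateChain R`:
kernel of the second map modulo the image of the first one. -/
abbrev StateHomology {S : Type*} [Finite S] (inc : S → S → ℤ) (P Q R : S → Prop) : Type _ :=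
  LinearMap.ker (stateMap inc Q R) ⧸
    (LinearMap.range (stateMap inc P Q)).submoduleOf (LinearMap.ker (stateMap inc Q R))

/-! ### Graph cohomology over `ℤ[x]/(x²)` (multigraphs, loops allowed) -/

namespace Graph

variable {α β : Type*}

/-- `G` has a cycle of length `n`: `n ≥ 1` distinct vertices `v 0, …, v (n-1)` and distinct edges
`e k` joining `v k` to `v (k+1)`, indices being taken modulo `n`. A loop is a cycle of length `1`,
two parallel edges form a cycle of length `2`. -/
def HasCycleOfLength (G : Graph α β) (n : ℕ) : Prop :=
  ∃ (_ : NeZero n) (v : Fin n → α) (e : Fin n → β),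
    Function.Injective v ∧ Function.Injective e ∧ ∀ k : Fin n, G.IsLink (e k) (v k) (v (k + 1))

/-- The length of a shortest cycle (`⊤` if there is no cycle). -/
noncomputable def girth (G : Graph α β) : ℕ∞ :=
  ⨅ (n : ℕ) (_ : G.HasCycleOfLength n), (n : ℕ∞)

/-- The connected components of the spanning subgraph `[G : s]`. -/
def SpanningComponent (G : Graph α β) (s : Finset β) : Type _ :=
  Quot fun u v : G.vertexSet => (G.restrict (s : Set β)).Adj u v

/-- The component of `[G : s]` containing `v`. -/
def spanningComponent (G : Graph α β) (s : Finset β) (v : G.vertexSet) : G.SpanningComponent s :=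
  Quot.mk _ v

/-- Enhanced states of `G`: a set of edges together with a label `1` or `x` on each component of
the spanning subgraph. The label `x ^ a` is recorded by its exponent `a : Fin 2`. For fixed
`edges` the enhanced states are the standard basis of the tensor product of copies of
`ℤ[x]/(x²)` indexed by the components. -/
@[ext]
structure EnhancedState (G : Graph α β) where
  edges : Finset β
  edges_subset : (edges : Set β) ⊆ G.edgeSet
  label : G.SpanningComponent edges → Fin 2

instance (G : Graph α β) [Finite α] (s : Finset β) : Finite (G.SpanningComponent s) :=
  Quot.finite _

instance (G : Graph α β) [Finite α] [Finite β] : Finite G.EnhancedState :=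
  Finite.of_injective
    (fun S : G.EnhancedState =>
      (⟨S.edges, S.label⟩ : Σ s : Finset β, (G.SpanningComponent s → Fin 2)))
    (by
      rintro ⟨s, hs, l⟩ ⟨t, ht, m⟩ h
      simp only [Sigma.mk.injEq] at h
      obtain ⟨rfl, h⟩ := h
      simp_all)

/-- `T` (with underlying edge set that of `S` together with `e`) occurs in the image of `S` under
the per-edge map of `e`. If `e` joins a component to itself, all labels are kept. If `e` joins two
different components, the label of the merged component is the product in `ℤ[x]/(x²)` of the two
labels (`x ^ a * x ^ b = x ^ (a + b)`, which is `0`, so that no `T` occurs, for `a = b = 1`), and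
the other labels are kept. -/
def EnhancedState.LabelStep {G : Graph α β} (e : β) (S T : G.EnhancedState) : Prop :=
  ∃ u v : G.vertexSet, G.IsLink e u v ∧
    let cS := G.spanningComponent S.edges
    let cT := G.spanningComponent T.edges
    (cS u = cS v ∧ ∀ w, T.label (cT w) = S.label (cS w)) ∨
    (cS u ≠ cS v ∧
      (T.label (cT u) : ℕ) = (S.label (cS u) : ℕ) + (S.label (cS v) : ℕ) ∧
      ∀ w, cS w ≠ cS u → cS w ≠ cS v → T.label (cT w) = S.label (cS w))

open Classical in
/-- Coefficient of `T` in `d S`: the sum over the edges `e` of the per-edge maps with sign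
`(-1)` to the number of edges of `S` preceding `e`. (At most one `e` contributes.) -/
noncomputable def EnhancedState.coeff [LinearOrder β] {G : Graph α β}
    (S T : G.EnhancedState) : ℤ :=
  ∑ e ∈ T.edges \ S.edges,
    if T.edges = insert e S.edges ∧ LabelStep e S T then
      (-1) ^ (S.edges.filter (· < e)).card
    else 0

/-- The degree of an enhanced state: the number of components labelled `x`. -/
noncomputable def EnhancedState.degree {G : Graph α β} (S : G.EnhancedState) : ℕ :=
  Nat.card {c : G.SpanningComponent S.edges // S.label c = 1}

/-- Enhanced states spanning `C^{i,j}(G)`: `i` edges, degree `j`. -/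
def EnhancedState.IsIn {G : Graph α β} (i j : ℤ) (S : G.EnhancedState) : Prop :=
  (S.edges.card : ℤ) = i ∧ (S.degree : ℤ) = j

/-- The graph cohomology group `H^{i,j}(G)` for the algebra `ℤ[x]/(x²)`, i.e. the cohomology of
`C^{i-1,j}(G) → C^{i,j}(G) → C^{i+1,j}(G)`. -/
abbrev Cohomology [LinearOrder β] [Finite α] [Finite β] (G : Graph α β) (i j : ℤ) : Type _ :=
  StateHomology (EnhancedState.coeff (G := G)) (EnhancedState.IsIn (i - 1) j)
    (EnhancedState.IsIn i j) (EnhancedState.IsIn (i + 1) j)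

end Graph

/-! ### Diagrams of unoriented framed links -/

/-- The combinatorial data of a link diagram on an oriented surface, with set of crossings `X` and
set `L` of components without crossings. The four strand ends at a crossing `c` are `(c, 0)`,
`(c, 1)`, `(c, 2)`, `(c, 3)` in counterclockwise order; `(c, 0)` and `(c, 2)` are the ends of the
understrand, `(c, 1)` and `(c, 3)` those of the overstrand. `arc` sends a strand end to the other
end of the arc of the diagram that leaves the crossing there. -/
structure DiagramData (X L : Type*) where
  arc : X × Fin 4 → X × Fin 4
  arc_arc : ∀ d, arc (arc d) = d
  arc_ne : ∀ d, arc d ≠ d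

namespace DiagramData

variable {X L : Type*}

/-- The corner at a crossing `c` between the ends `(c, k)` and `(c, k + 1)` is denoted `(c, k)`.
Walking around a face with the face on the right hand side, one leaves the corner `(c, k)` along
the arc starting at `(c, k + 1)`. -/
def nextCorner (D : DiagramData X L) (d : X × Fin 4) : X × Fin 4 := D.arc (d.1, d.2 + 1)

/-- The faces of the diagram: cyclic sequences of corners. -/
def Face (D : DiagramData X L) : Type _ := Quot fun d d' : X × Fin 4 => d' = D.nextCorner d

/-- The face to which a corner belongs. -/
def face (D : DiagramData X L) (d : X × Fin 4) : D.Face := Quot.mk _ d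

/-- The connected pieces of the diagram that contain crossings. -/
def Piece (D : DiagramData X L) : Type _ :=
  Quot fun c c' : X => ∃ k k' : Fin 4, D.arc (c, k) = (c', k')

end DiagramData

/-- A diagram of an unoriented framed link in the plane (or sphere), with the blackboard framing.
With `n` crossings there are `2 n` arcs between crossings, so `planar` says that the Euler
characteristic is `2` for every connected piece that contains crossings. (The Euler characteristic
of a piece is at most `2`, so the equality of the sums is the equality for each piece.) -/
structure LinkDiagram (X L : Type*) extends DiagramData X L where
  planar : (Nat.card X : ℤ) - 2 * Nat.card X + Nat.card toDiagramData.Face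
    = 2 * Nat.card toDiagramData.Piece

namespace LinkDiagram

variable {X L : Type*}

/-- Travelling along any component one meets over- and undercrossings alternately: every arc has
one end at an overstrand and the other one at an understrand. -/
def IsAlternating (D : LinkDiagram X L) : Prop :=
  ∀ d, ((D.arc d).2 : ℕ) % 2 ≠ (d.2 : ℕ) % 2

/-- The shaded faces of the chessboard colouring used for the Tait graph: those containing a
corner `(c, 0)` or `(c, 2)`. These are the two corners at `c` that the `A`-smoothing separates. In
an alternating diagram all corners of a shaded face are of this kind. -/
def IsShaded (D : LinkDiagram X L) (f : D.Face) : Prop :=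
  ∃ c : X, f = D.face (c, 0) ∨ f = D.face (c, 2)

/-- The vertices of the Tait graph: the shaded faces, and one isolated vertex for each component
without crossings. -/
abbrev TaitVertex (D : LinkDiagram X L) : Type _ := {f : D.Face // D.IsShaded f} ⊕ L

/-- The Tait graph: each crossing is an edge joining the shaded faces at its two shaded corners. -/
def taitGraph (D : LinkDiagram X L) : Graph D.TaitVertex X where
  vertexSet := Set.univ
  edgeSet := Set.univ
  IsLink c u v :=
    s(u, v) = s(Sum.inl ⟨D.face (c, 0), c, Or.inl rfl⟩, Sum.inl ⟨D.face (c, 2), c, Or.inr rfl⟩)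
  isLink_symm := fun _ _ => ⟨fun u v h => by rw [Sym2.eq_swap]; exact h⟩
  eq_or_eq_of_isLink_of_isLink := by
    intro e x y v w h h'
    have hh := h.trans h'.symm
    rw [Sym2.eq_iff] at hh
    tauto
  edge_mem_iff_exists_isLink := fun _ => ⟨fun _ => ⟨_, _, rfl⟩, fun _ => trivial⟩
  left_mem_of_isLink := fun _ _ _ _ => trivial

/-- How a smoothing reconnects the four ends at a crossing. The `0`-marker (`A`-smoothing) joins
the two regions swept out when the overstrand is turned counterclockwise, so it connects `0` with
`1` and `2` with `3`. The `1`-marker (`A⁻¹`-smoothing) connects `1` with `2` and `3` with `0`. -/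
def smoothEnd (marker1 : Prop) [Decidable marker1] (k : Fin 4) : Fin 4 :=
  if marker1 then ![3, 2, 1, 0] k else ![1, 0, 3, 2] k

/-- Two ends are adjacent in the smoothing with `1`-markers exactly at the crossings in `s`: they
are joined by an arc of the diagram or by the smoothing at a crossing. -/
def SmoothAdj [DecidableEq X] (D : LinkDiagram X L) (s : Finset X) (d d' : X × Fin 4) : Prop :=
  d' = D.arc d ∨ d' = (d.1, smoothEnd (d.1 ∈ s) d.2)

/-- The circles of the smoothing with `1`-markers exactly at the crossings in `s`. -/
abbrev Circle [DecidableEq X] (D : LinkDiagram X L) (s : Finset X) : Type _ :=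
  Quot (D.SmoothAdj s) ⊕ L

/-- The circle through a strand end. -/
def circleAt [DecidableEq X] (D : LinkDiagram X L) (s : Finset X) (d : X × Fin 4) : D.Circle s :=
  Sum.inl (Quot.mk _ d)

/-- Enhanced Kauffman states: a marker at each crossing (`ones` is the set of crossings with a
`1`-marker) and a label `1` or `x` on each circle (`+` or `-` in Viro's notation). The label
`x ^ a` is recorded by its exponent `a : Fin 2`. -/
@[ext]
structure EnhancedState [DecidableEq X] (D : LinkDiagram X L) where
  ones : Finset X
  label : D.Circle ones → Fin 2

instance [Finite X] (D : LinkDiagram X L) : Finite D.Face := Quot.finite _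

instance [DecidableEq X] [Finite X] [Finite L] (D : LinkDiagram X L) : Finite D.EnhancedState :=
  Finite.of_injective
    (fun S : D.EnhancedState => (⟨S.ones, S.label⟩ : Σ s : Finset X, (D.Circle s → Fin 2)))
    (by
      rintro ⟨s, l⟩ ⟨t, m⟩ h
      simp only [Sigma.mk.injEq] at h
      obtain ⟨rfl, h⟩ := h
      simp_all)

namespace EnhancedState

section

variable [DecidableEq X] {D : LinkDiagram X L}

/-- `σ(S)`: the number of `0`-markers minus the number of `1`-markers. -/
noncomputable def sigma (S : D.EnhancedState) : ℤ :=
  Nat.card {c : X // c ∉ S.ones} - Nat.card {c : X // c ∈ S.ones}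

/-- `p(S)`: the number of circles labelled `1` minus the number of circles labelled `x`. -/
noncomputable def p (S : D.EnhancedState) : ℤ :=
  Nat.card {C : D.Circle S.ones // S.label C = 0} - Nat.card {C : D.Circle S.ones // S.label C = 1}

/-- `q(S) = σ(S) - 2 p(S)`. -/
noncomputable def q (S : D.EnhancedState) : ℤ := S.sigma - 2 * S.p

/-- `T` (with the markers of `S`, except that the `0`-marker at `c` becomes a `1`-marker) occurs in
the differential of `S`: the circles not passing near `c` keep their labels, and `p` drops by one.
The latter condition means for two circles merging into one: `1·1 = 1`, `1·x = x·1 = x`, `x·x = 0`;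
and for a circle splitting into two: `1 ↦ 1 ⊗ x + x ⊗ 1`, `x ↦ x ⊗ x`. -/
def LabelStep (c : X) (S T : D.EnhancedState) : Prop :=
  (∀ d : X × Fin 4, (∀ k, D.circleAt S.ones d ≠ D.circleAt S.ones (c, k)) →
    T.label (D.circleAt T.ones d) = S.label (D.circleAt S.ones d)) ∧
  (∀ l : L, T.label (Sum.inr l) = S.label (Sum.inr l)) ∧
  T.p = S.p - 1

end

variable [LinearOrder X] {D : LinkDiagram X L}

open Classical in
/-- The incidence number of `S` and `T` in the Khovanov complex. (At most one crossing `c`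
contributes; the sign counts the `1`-markers of `S` at crossings preceding `c`.) -/
noncomputable def coeff (S T : D.EnhancedState) : ℤ :=
  ∑ c ∈ T.ones \ S.ones,
    if T.ones = insert c S.ones ∧ LabelStep c S T then
      (-1) ^ (S.ones.filter (· < c)).card
    else 0

end EnhancedState

variable [LinearOrder X] [Finite X] [Finite L]

/-- Viro's Khovanov homology `H_{p,q}(D)` of a diagram of an unoriented framed link. The chain
group `C_{p,q}(D)` is spanned by the enhanced states `S` with `p(S) = p` and `q(S) = q`, and the
differential goes from `C_{p,q}(D)` to `C_{p-1,q}(D)`. -/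
abbrev Homology (D : LinkDiagram X L) (p q : ℤ) : Type _ :=
  StateHomology (EnhancedState.coeff (D := D))
    (fun S => S.p = p + 1 ∧ S.q = q) (fun S => S.p = p ∧ S.q = q)
    (fun S => S.p = p - 1 ∧ S.q = q)

/-- The same homology with the chain groups `C_{a,b}(D)` spanned by the enhanced states `S` with
`σ(S) = a` and `q(S) = b`; the differential goes from `C_{a,b}(D)` to `C_{a-2,b}(D)`. -/
abbrev SigmaHomology (D : LinkDiagram X L) (a b : ℤ) : Type _ :=
  StateHomology (EnhancedState.coeff (D := D))
    (fun S => S.sigma = a + 2 ∧ S.q = b) (fun S => S.sigma = a ∧ S.q = b)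
    (fun S => S.sigma = a - 2 ∧ S.q = b)

end LinkDiagram

set_option linter.unusedSectionVars false

/-! ### Cycles of a permutation multiplied by a transposition -/

namespace Equiv.Perm

variable {α : Type*} [DecidableEq α] {π π' : Perm α} {x y : α}

/-! A set `s` of fewer than `ℓ` edges is a forest. The smoothing with `1`-markers at `s` consists of
the boundary curves of a neighbourhood of `[G:s]`, and for a forest there is exactly one curve per
component. States therefore correspond: put the label of a component on its circle
(`kauffmanState`). An edge joining two components merges two circles, and both differentials
multiply the labels. They first differ when an edge closes a cycle: the graph differential then
keeps all labels, while a circle splits.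

The topology is replaced by permutations. Since the diagram alternates, the circles are the cycles
of a permutation of the even strand ends (`circlePerm`), and changing a marker multiplies it by a
transposition, which merges or splits cycles. Circles always refine components
(`componentAt_eq_of_circleOf_eq`); the converse for forests is an induction on the number of edges
(`circleComponent_injective`).

Labels are treated as integer exponents. Multiplying in `ℤ[x]/(x²)` adds exponents, so a step of the
graph differential says that the new labels are the fibre sums of the old ones; `x·x = 0` holds
because no label has exponent `2`. With the normalisation in `componentLabel`, merges and splits of
circles starting from a forest satisfy the same equation (`EnhancedState.labelStep_iff`).

For `i < ℓ - 1` the degrees `i - 1`, `i`, `i + 1` all lie below the girth, so the two three-term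
pieces are isomorphic. For `i = ℓ - 1` only the incoming differentials are known to agree. That
suffices for torsion: if `d₂ d₁ = 0` and the target of `d₂` is torsion free, every torsion class of
`coker d₁` is represented by a cycle, so the torsion of the homology is that of `coker d₁`. The
vanishing of `d₂ d₁` comes from functoriality of fibre sums and the usual cube signs, also when the
second step splits a circle. -/

lemma mul_swap_apply_of_ne (h : π' = π * swap x y) {z : α} (hx : z ≠ x) (hy : z ≠ y) :
    π' z = π z := by
  rw [h, mul_apply, swap_apply_of_ne_of_ne hx hy]

lemma eq_mul_swap_symm (h : π' = π * swap x y) : π = π' * swap x y := by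
  rw [h, mul_assoc, swap_mul_self, mul_one]

lemma SameCycle.exists_nat_pow [Finite α] {a b : α} (h : SameCycle π a b) :
    ∃ n : ℕ, (π ^ n) a = b := by
  obtain ⟨n, -, hn⟩ := h.exists_pow_eq'
  exact ⟨n, hn⟩

/-- On a finite set forward iteration already reaches the whole cycle, so an invariant need only
survive one application of `π`. -/
lemma SameCycle.mem_of_forward [Finite α] {a b : α} (h : SameCycle π a b) {p : α → Prop}
    (ha : p a) (hp : ∀ z, SameCycle π a z → p z → p (π z)) : p b := by
  obtain ⟨n, rfl⟩ := h.exists_nat_pow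
  clear h
  induction n with
  | zero => simpa using ha
  | succ n ih =>
    rw [pow_succ', mul_apply]
    exact hp _ ⟨n, by simp⟩ ih

/-- If `x` and `y` lie in different cycles of `π`, then multiplication by their transposition
merges these cycles. -/
lemma sameCycle_or_sameCycle_mul_swap [Finite α] (h : π' = π * swap x y) :
    SameCycle π x y ∨ SameCycle π' x y := by
  by_contra! hc
  obtain ⟨h1, h2⟩ := hc
  have hy : π' y = π x := by rw [h, mul_apply, swap_apply_right]
  -- From `y` the permutation `π'` jumps to `π x` and then follows the `π`-cycle of `x`; it cannot
  -- meet `y` there, so it closes up at `x`.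
  have key : SameCycle π' y x := by
    have hs : SameCycle π (π x) x := sameCycle_apply_left.2 (SameCycle.refl _ _)
    refine hs.mem_of_forward (p := fun z => SameCycle π' y z) ?_ ?_
    · rw [← hy]; exact sameCycle_apply_right.2 (SameCycle.refl _ _)
    · intro z hz hz'
      have hx : z ≠ x := by rintro rfl; exact h2 hz'.symm
      have hy' : z ≠ y := by rintro rfl; exact h1 (hs.symm.trans hz)
      rw [← mul_swap_apply_of_ne h hx hy']
      exact sameCycle_apply_right.2 hz'
  exact h2 key.symm

/-- If `x` and `y` lie in the same cycle of `π`, then multiplication by their transposition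
splits this cycle. -/
lemma SameCycle.not_sameCycle_mul_swap [Finite α] (hxy : x ≠ y) (h : π' = π * swap x y)
    (hs : SameCycle π x y) : ¬ SameCycle π' x y := by
  classical
  intro hs'
  have hex : ∃ k, (π ^ k) x = y := hs.exists_nat_pow
  set k := Nat.find hex with hk
  have hky : (π ^ k) x = y := Nat.find_spec hex
  have hmin : ∀ m < k, (π ^ m) x ≠ y := fun m hm => Nat.find_min hex hm
  have hk0 : 0 < k := by
    rcases Nat.eq_zero_or_pos k with h0 | h0
    · rw [h0] at hky; exact absurd hky hxy
    · exact h0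
  have hnx : ∀ i, 0 < i → i ≤ k → (π ^ i) x ≠ x := by
    intro i hi hik he
    apply hmin (k - i) (by omega)
    rw [← hky]
    conv_rhs => rw [← Nat.sub_add_cancel hik, pow_add, mul_apply, he]
  -- The segment `π x, …, π ^ k x = y` is stable under `π'`, because `π'` sends its end `y` back to
  -- `π x`. It contains `y` but not `x`.
  have : ∃ i, 0 < i ∧ i ≤ k ∧ (π ^ i) x = x := by
    refine hs'.symm.mem_of_forward (p := fun z => ∃ i, 0 < i ∧ i ≤ k ∧ (π ^ i) x = z)
      ⟨k, hk0, le_rfl, hky⟩ ?_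
    rintro _ - ⟨i, hi, hik, rfl⟩
    rcases hik.eq_or_lt with rfl | hlt
    · refine ⟨1, one_pos, hk0, ?_⟩
      rw [hky, h, mul_apply, swap_apply_right, pow_one]
    · refine ⟨i + 1, i.succ_pos, hlt, ?_⟩
      rw [mul_swap_apply_of_ne h (hnx i hi hik) (hmin i hlt), pow_succ', mul_apply]
  obtain ⟨i, hi, hik, he⟩ := this
  exact hnx i hi hik he

/-- A walk along `π'` leaves a cycle of `π` only at `x` or `y`, where it jumps to the successor of
the other point. -/
lemma SameCycle.of_mul_swap [Finite α] (h : π' = π * swap x y) {a b : α} (hab : SameCycle π' a b) :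
    SameCycle π a b ∨ ((SameCycle π a x ∨ SameCycle π a y) ∧
      (SameCycle π b x ∨ SameCycle π b y)) := by
  refine hab.mem_of_forward (p := fun b => SameCycle π a b ∨
    ((SameCycle π a x ∨ SameCycle π a y) ∧ (SameCycle π b x ∨ SameCycle π b y)))
    (Or.inl (SameCycle.refl _ _)) ?_
  intro z _ hz
  by_cases hx : z = x
  · subst hx
    have : π' z = π y := by rw [h, mul_apply, swap_apply_left]
    rw [this]
    have h2 : SameCycle π (π y) y := sameCycle_apply_left.2 (SameCycle.refl _ _)
    rcases hz with hz | hz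
    · exact Or.inr ⟨Or.inl hz, Or.inr h2⟩
    · exact Or.inr ⟨hz.1, Or.inr h2⟩
  by_cases hy : z = y
  · subst hy
    have : π' z = π x := by rw [h, mul_apply, swap_apply_right]
    rw [this]
    have h2 : SameCycle π (π x) x := sameCycle_apply_left.2 (SameCycle.refl _ _)
    rcases hz with hz | hz
    · exact Or.inr ⟨Or.inr hz, Or.inl h2⟩
    · exact Or.inr ⟨hz.1, Or.inl h2⟩
  · rw [mul_swap_apply_of_ne h hx hy, sameCycle_apply_right, sameCycle_apply_left,
      sameCycle_apply_left]
    exact hz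

/-- The cycles of `π * swap x y` when `x` and `y` lie in different cycles of `π`. -/
lemma sameCycle_mul_swap_iff [Finite α] (h : π' = π * swap x y)
    (hn : ¬ SameCycle π x y) (a b : α) :
    SameCycle π' a b ↔ SameCycle π a b ∨ ((SameCycle π a x ∨ SameCycle π a y) ∧
      (SameCycle π b x ∨ SameCycle π b y)) := by
  have hxy : SameCycle π' x y := (sameCycle_or_sameCycle_mul_swap h).resolve_left hn
  have mono : ∀ {a b}, SameCycle π a b → SameCycle π' a b := by
    intro a b hab
    rcases hab.of_mul_swap (eq_mul_swap_symm h) with h1 | ⟨h1 | h1, h2 | h2⟩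
    · exact h1
    · exact h1.trans h2.symm
    · exact h1.trans (hxy.trans h2.symm)
    · exact h1.trans (hxy.symm.trans h2.symm)
    · exact h1.trans h2.symm
  refine ⟨SameCycle.of_mul_swap h, ?_⟩
  rintro (h1 | ⟨h1 | h1, h2 | h2⟩)
  · exact mono h1
  · exact (mono h1).trans (mono h2).symm
  · exact (mono h1).trans (hxy.trans (mono h2).symm)
  · exact (mono h1).trans (hxy.symm.trans (mono h2).symm)
  · exact (mono h1).trans (mono h2).symm

end Equiv.Perm

/-! ### Sums over fibres -/

section FiberSum

variable {A B C : Type*}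

/-- The sum of an integer valued function over a finite type. -/
noncomputable def total [Finite A] (f : A → ℤ) : ℤ :=
  letI := Fintype.ofFinite A
  ∑ a, f a

open Classical in
/-- The sum of `f` over the fibre of `r` above `b`. -/
noncomputable def fiberSum [Finite A] (r : A → B) (f : A → ℤ) (b : B) : ℤ :=
  total fun a => if r a = b then f a else 0

/-- `r` is surjective and identifies exactly the two different points `x` and `y`. -/
structure IsMerge (r : A → B) (x y : A) : Prop where
  surj : Function.Surjective r
  ne : x ≠ y
  eq_iff : ∀ a b, r a = r b ↔ a = b ∨ ((a = x ∨ a = y) ∧ (b = x ∨ b = y))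

variable [Finite A] [Finite B]

lemma total_eq_sum [Fintype A] (f : A → ℤ) : total f = ∑ a, f a := by
  unfold total
  congr!

lemma total_sub (f g : A → ℤ) : total (fun a => f a - g a) = total f - total g := by
  simp only [total, Finset.sum_sub_distrib]

lemma total_mul_left (c : ℤ) (f : A → ℤ) : total (fun a => c * f a) = c * total f := by
  simp only [total, Finset.mul_sum]

lemma total_one : total (fun _ : A => 1) = (Nat.card A : ℤ) := by
  let _ := Fintype.ofFinite A
  simp [total_eq_sum]

lemma total_nonneg {f : A → ℤ} (hf : ∀ a, 0 ≤ f a) : 0 ≤ total f :=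
  Finset.sum_nonneg fun a _ => hf a

lemma apply_le_total {f : A → ℤ} (hf : ∀ a, 0 ≤ f a) (a : A) : f a ≤ total f := by
  let _ := Fintype.ofFinite A
  rw [total_eq_sum]
  exact Finset.single_le_sum (fun a _ => hf a) (Finset.mem_univ a)

lemma total_of_support_subset_pair {f : A → ℤ} {x y : A} (hxy : x ≠ y)
    (hf : ∀ a, a ≠ x → a ≠ y → f a = 0) : total f = f x + f y := by
  classical
  let _ := Fintype.ofFinite A
  rw [total_eq_sum]
  exact Finset.sum_eq_add x y hxy (fun c _ hc => hf c hc.1 hc.2) (by simp) (by simp)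

lemma total_of_support_subset_singleton {f : A → ℤ} {x : A}
    (hf : ∀ a, a ≠ x → f a = 0) : total f = f x := by
  let _ := Fintype.ofFinite A
  rw [total_eq_sum]
  exact Finset.sum_eq_single x (fun c _ hc => hf c hc) (by simp)

lemma total_comp_of_bijective {r : A → B} (hr : Function.Bijective r) (g : B → ℤ) :
    total (fun a => g (r a)) = total g := by
  let _ := Fintype.ofFinite A
  let _ := Fintype.ofFinite B
  rw [total_eq_sum, total_eq_sum]
  exact Fintype.sum_bijective r hr _ _ fun _ => rfl

lemma total_comm (f : A → B → ℤ) :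
    total (fun a => total (f a)) = total fun b => total fun a => f a b :=
  Finset.sum_comm

/-- Each point lies in exactly one fibre. This is what makes the graph differential preserve degree.
-/
lemma total_fiberSum (r : A → B) (f : A → ℤ) : total (fiberSum r f) = total f := by
  unfold fiberSum
  rw [total_comm]
  congr 1
  funext a
  rw [total_of_support_subset_singleton (x := r a)]
  · simp
  · intro b hb; rw [if_neg (Ne.symm hb)]

/-- Functoriality of the pushforward: the source of the commutativity of the squares in both cubes.
-/
lemma fiberSum_comp (q : B → C) (r : A → B) (f : A → ℤ) :
    fiberSum q (fiberSum r f) = fiberSum (fun a => q (r a)) f := by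
  classical
  funext c
  calc fiberSum q (fiberSum r f) c
      = total fun b => total fun a => if q b = c then (if r a = b then f a else 0) else 0 := by
        unfold fiberSum
        congr 1
        funext b
        by_cases h : q b = c
        · simp [h]
        · simp [h, total]
    _ = total fun a => total fun b => if q b = c then (if r a = b then f a else 0) else 0 :=
        total_comm _
    _ = fiberSum (fun a => q (r a)) f c := by
        unfold fiberSum
        congr 1
        funext a
        rw [total_of_support_subset_singleton (x := r a)]
        · simp
        · intro b hb; simp [Ne.symm hb]

lemma fiberSum_nonneg (r : A → B) {f : A → ℤ} (hf : ∀ a, 0 ≤ f a) (b : B) :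
    0 ≤ fiberSum r f b :=
  total_nonneg fun a => by split_ifs <;> simp [hf]

lemma le_fiberSum (r : A → B) {f : A → ℤ} (hf : ∀ a, 0 ≤ f a) (a : A) :
    f a ≤ fiberSum r f (r a) := by
  classical
  have := apply_le_total (f := fun a' => if r a' = r a then f a' else 0)
    (fun a' => by split_ifs <;> simp [hf]) a
  simpa [fiberSum] using this

lemma fiberSum_neg (r : A → B) (f : A → ℤ) (b : B) :
    fiberSum r (fun a => - f a) b = - fiberSum r f b := by
  unfold fiberSum
  rw [← neg_one_mul, ← total_mul_left]
  congr 1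
  funext a
  split_ifs <;> simp

lemma fiberSum_of_injective {r : A → B} (hr : Function.Injective r) (f : A → ℤ) (a : A) :
    fiberSum r f (r a) = f a := by
  classical
  unfold fiberSum
  rw [total_of_support_subset_singleton (x := a)]
  · simp
  · intro b hb; rw [if_neg fun h => hb (hr h)]

lemma eq_fiberSum_of_bijective_iff {r : A → B} (hr : Function.Bijective r) (f : A → ℤ)
    (g : B → ℤ) : g = fiberSum r f ↔ ∀ a, g (r a) = f a := by
  constructor
  · rintro rfl a; exact fiberSum_of_injective hr.1 f a
  · intro h; funext b
    obtain ⟨a, rfl⟩ := hr.2 b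
    rw [h, fiberSum_of_injective hr.1]

/-! ### Fibre sums along a map identifying two points -/

namespace IsMerge

variable {r : A → B} {x y : A}

lemma map_eq (h : IsMerge r x y) : r x = r y := (h.eq_iff x y).2 (by simp)

lemma map_ne (h : IsMerge r x y) {a : A} (hx : a ≠ x) (hy : a ≠ y) : r a ≠ r x := by
  intro he
  rcases (h.eq_iff a x).1 he with h1 | ⟨h1 | h1, -⟩
  exacts [hx h1, hx h1, hy h1]

lemma fiberSum_apply (h : IsMerge r x y) (f : A → ℤ) : fiberSum r f (r x) = f x + f y := by
  classical
  unfold fiberSum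
  rw [total_of_support_subset_pair h.ne]
  · rw [if_pos rfl, if_pos h.map_eq.symm]
  · intro a hx hy; rw [if_neg (h.map_ne hx hy)]

lemma fiberSum_apply_of_ne (h : IsMerge r x y) (f : A → ℤ) {a : A} (hx : a ≠ x) (hy : a ≠ y) :
    fiberSum r f (r a) = f a := by
  classical
  unfold fiberSum
  rw [total_of_support_subset_singleton (x := a)]
  · simp
  · intro b hb
    rw [if_neg]
    intro he
    rcases (h.eq_iff b a).1 he with h1 | ⟨-, h1 | h1⟩
    exacts [hb h1, hx h1, hy h1]

/-- The difference between `g` and the pushforward of `f` is supported at the merged point. It lets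
a condition on totals, such as the drop of `p`, be read as one on the label there. -/
lemma total_eq (h : IsMerge r x y) {f : A → ℤ} {g : B → ℤ}
    (hfg : ∀ a, a ≠ x → a ≠ y → g (r a) = f a) :
    total f = total g + f x + f y - g (r x) := by
  have h1 : total (fun b => fiberSum r f b - g b) = fiberSum r f (r x) - g (r x) := by
    apply total_of_support_subset_singleton
    intro b hb
    obtain ⟨a, rfl⟩ := h.surj b
    have hx : a ≠ x := by rintro rfl; exact hb rfl
    have hy : a ≠ y := by rintro rfl; exact hb h.map_eq.symm
    rw [h.fiberSum_apply_of_ne f hx hy, hfg a hx hy, sub_self]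
  rw [total_sub, total_fiberSum, h.fiberSum_apply] at h1
  linarith

lemma card_eq (h : IsMerge r x y) : (Nat.card A : ℤ) = Nat.card B + 1 := by
  have := h.total_eq (f := fun _ => 1) (g := fun _ => 1) (fun _ _ _ => rfl)
  rw [total_one, total_one] at this
  linarith

lemma eq_fiberSum_iff (h : IsMerge r x y) (f : A → ℤ) (g : B → ℤ) :
    g = fiberSum r f ↔ (∀ a, a ≠ x → a ≠ y → g (r a) = f a) ∧ g (r x) = f x + f y := by
  constructor
  · rintro rfl
    exact ⟨fun a hx hy => h.fiberSum_apply_of_ne f hx hy, h.fiberSum_apply f⟩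
  · rintro ⟨h1, h2⟩
    funext b
    obtain ⟨a, rfl⟩ := h.surj b
    by_cases hx : a = x
    · rw [hx, h2, h.fiberSum_apply]
    by_cases hy : a = y
    · rw [hy, ← h.map_eq, h2, h.fiberSum_apply]
    · rw [h1 a hx hy, h.fiberSum_apply_of_ne f hx hy]

/-- Merging two labels: the product in `ℤ[x]/(x²)` in terms of the change of `p`. -/
lemma merge_label_iff (h : IsMerge r x y) (f : A → ℤ) (g : B → ℤ) :
    ((∀ a, a ≠ x → a ≠ y → g (r a) = f a) ∧
      total (fun b => 1 - 2 * g b) = total (fun a => 1 - 2 * f a) - 1) ↔ g = fiberSum r f := by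
  rw [h.eq_fiberSum_iff]
  refine and_congr_right fun h1 => ?_
  have := h.total_eq (f := fun a => 1 - 2 * f a) (g := fun b => 1 - 2 * g b)
    (fun a hx hy => by rw [h1 a hx hy])
  constructor <;> intro h2 <;> linarith

/-- Splitting a label: the coproduct of `ℤ[x]/(x²)` in terms of the change of `p`. -/
lemma split_label_iff (h : IsMerge r x y) (f : A → ℤ) (g : B → ℤ) :
    ((∀ a, a ≠ x → a ≠ y → f a = g (r a)) ∧
      total (fun a => 1 - 2 * f a) = total (fun b => 1 - 2 * g b) - 1) ↔
    (fun b => 1 + fiberSum r (fun a => f a - 1) b) = g := by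
  -- The coproduct imposes `g = f x + f y - 1`; after subtracting `1` from every label this is an
  -- ordinary fibre sum.
  have e1 : ((fun b => 1 + fiberSum r (fun a => f a - 1) b) = g) ↔
      (fun b => g b - 1) = fiberSum r (fun a => f a - 1) := by
    simp only [funext_iff]
    refine forall_congr' fun b => ⟨fun h => by linarith, fun h => by linarith⟩
  rw [e1, h.eq_fiberSum_iff]
  have e2 : (∀ a, a ≠ x → a ≠ y → f a = g (r a)) ↔
      (∀ a, a ≠ x → a ≠ y → g (r a) - 1 = f a - 1) :=
    forall_congr' fun a => forall_congr' fun _ => forall_congr' fun _ =>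
      ⟨fun h => by linarith, fun h => by linarith⟩
  rw [e2]
  refine and_congr_right fun h1 => ?_
  have := h.total_eq (f := fun a => 1 - 2 * f a) (g := fun b => 1 - 2 * g b)
    (fun a hx hy => by linarith [h1 a hx hy])
  constructor <;> intro h2 <;> linarith

end IsMerge

end FiberSum

/-! ### Homology of three-term pieces -/

section Homology

variable {A B C A' B' C' : Type*} [AddCommGroup A] [AddCommGroup B] [AddCommGroup C]
  [AddCommGroup A'] [AddCommGroup B'] [AddCommGroup C']

/-- Isomorphic three-term sequences have isomorphic homology. -/
lemma nonempty_homology_equiv (d₁ : A →ₗ[ℤ] B) (d₂ : B →ₗ[ℤ] C) (d₁' : A' →ₗ[ℤ] B')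
    (d₂' : B' →ₗ[ℤ] C') (eA : A ≃ₗ[ℤ] A') (eB : B ≃ₗ[ℤ] B') (eC : C ≃ₗ[ℤ] C')
    (h₁ : ∀ a, eB (d₁ a) = d₁' (eA a)) (h₂ : ∀ b, eC (d₂ b) = d₂' (eB b)) :
    Nonempty ((LinearMap.ker d₂ ⧸ (LinearMap.range d₁).submoduleOf (LinearMap.ker d₂)) ≃+
      (LinearMap.ker d₂' ⧸ (LinearMap.range d₁').submoduleOf (LinearMap.ker d₂'))) := by
  have hk : (LinearMap.ker d₂).map (eB : B →ₗ[ℤ] B') = LinearMap.ker d₂' := by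
    ext y
    obtain ⟨x, rfl⟩ := eB.surjective y
    simp only [Submodule.mem_map, LinearMap.mem_ker, LinearEquiv.coe_coe,
      EmbeddingLike.apply_eq_iff_eq, exists_eq_right]
    rw [← h₂, LinearEquiv.map_eq_zero_iff]
  have hr : ∀ b, eB b ∈ LinearMap.range d₁' ↔ b ∈ LinearMap.range d₁ := by
    intro b
    constructor
    · rintro ⟨a', ha⟩
      obtain ⟨a, rfl⟩ := eA.surjective a'
      rw [← h₁] at ha
      exact ⟨a, eB.injective ha⟩
    · rintro ⟨a, rfl⟩
      exact ⟨eA a, (h₁ a).symm⟩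
  refine ⟨(Submodule.Quotient.equiv _ _ (eB.ofSubmodules _ _ hk) ?_).toAddEquiv⟩
  ext ⟨y, hy⟩
  obtain ⟨x, rfl⟩ := eB.surjective y
  have hx : x ∈ LinearMap.ker d₂ := by
    rw [LinearMap.mem_ker] at hy ⊢
    rwa [← h₂, LinearEquiv.map_eq_zero_iff] at hy
  simp only [Submodule.mem_map, Submodule.submoduleOf, Submodule.mem_comap, Submodule.subtype_apply]
  rw [hr]
  constructor
  · rintro ⟨⟨z, hz⟩, hz', he⟩
    have : eB z = eB x := congrArg Subtype.val he
    exact eB.injective this ▸ hz'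
  · intro h
    exact ⟨⟨x, hx⟩, h, rfl⟩

/-- An injective homomorphism whose image contains all torsion elements induces an isomorphism of
torsion subgroups. -/
lemma nonempty_torsion_equiv_of_injective (f : A →+ B) (hf : Function.Injective f)
    (hs : ∀ b ∈ AddCommGroup.torsion B, ∃ a, f a = b) :
    Nonempty (AddCommGroup.torsion A ≃+ AddCommGroup.torsion B) := by
  let g : AddCommGroup.torsion A →+ AddCommGroup.torsion B :=
    (f.comp (AddCommGroup.torsion A).subtype).codRestrict _ fun a => f.isOfFinAddOrder a.2
  refine ⟨AddEquiv.ofBijective g ⟨fun a b h => Subtype.ext (hf (congrArg Subtype.val h)), ?_⟩⟩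
  rintro ⟨b, hb⟩
  obtain ⟨a, rfl⟩ := hs b hb
  exact ⟨⟨a, (hf.isOfFinAddOrder_iff).1 hb⟩, rfl⟩

/-- The torsion of the homology at the middle term does not depend on the second map. -/
lemma nonempty_torsion_homology_equiv [IsAddTorsionFree C] (d₁ : A →ₗ[ℤ] B) (d₂ : B →ₗ[ℤ] C)
    (h : ∀ a, d₂ (d₁ a) = 0) :
    Nonempty (AddCommGroup.torsion
        (LinearMap.ker d₂ ⧸ (LinearMap.range d₁).submoduleOf (LinearMap.ker d₂)) ≃+
      AddCommGroup.torsion (B ⧸ LinearMap.range d₁)) := by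
  let f := Submodule.mapQ ((LinearMap.range d₁).submoduleOf (LinearMap.ker d₂))
    (LinearMap.range d₁) (LinearMap.ker d₂).subtype le_rfl
  refine nonempty_torsion_equiv_of_injective f.toAddMonoidHom ?_ ?_
  · change Function.Injective f
    rw [injective_iff_map_eq_zero]
    intro y hy
    obtain ⟨x, rfl⟩ := Submodule.Quotient.mk_surjective _ y
    exact (Submodule.Quotient.mk_eq_zero _).2
      ((Submodule.Quotient.mk_eq_zero (LinearMap.range d₁)).1 hy)
  · intro b hb
    obtain ⟨x, rfl⟩ := Submodule.Quotient.mk_surjective _ b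
    obtain ⟨n, hn, hx⟩ := isOfFinAddOrder_iff_nsmul_eq_zero.1 hb
    rw [← Submodule.Quotient.mk_smul, Submodule.Quotient.mk_eq_zero] at hx
    obtain ⟨a, ha⟩ := hx
    -- Some positive multiple of `x` is a boundary, so `n • d₂ x = 0`, and `C` has no torsion: `x`
    -- is a cycle.
    have h0 : d₂ x = 0 := by
      have := h a
      rw [ha, map_nsmul] at this
      exact (smul_eq_zero_iff_right hn.ne').1 this
    exact ⟨Submodule.Quotient.mk ⟨x, h0⟩, rfl⟩

lemma nonempty_torsion_equiv (e : A ≃+ B) :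
    Nonempty (AddCommGroup.torsion A ≃+ AddCommGroup.torsion B) :=
  nonempty_torsion_equiv_of_injective e.toAddMonoidHom e.injective fun b _ => e.surjective b

/-- The torsion of the homology at the middle term depends on the first map only. -/
lemma nonempty_torsion_equiv_of_comm [IsAddTorsionFree C] [IsAddTorsionFree C']
    (d₁ : A →ₗ[ℤ] B) (d₂ : B →ₗ[ℤ] C) (d₁' : A' →ₗ[ℤ] B')
    (d₂' : B' →ₗ[ℤ] C') (eA : A ≃ₗ[ℤ] A') (eB : B ≃ₗ[ℤ] B')
    (h₁ : ∀ a, eB (d₁ a) = d₁' (eA a)) (h : ∀ a, d₂ (d₁ a) = 0) (h' : ∀ a, d₂' (d₁' a) = 0) :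
    Nonempty (AddCommGroup.torsion
        (LinearMap.ker d₂ ⧸ (LinearMap.range d₁).submoduleOf (LinearMap.ker d₂)) ≃+
      AddCommGroup.torsion
        (LinearMap.ker d₂' ⧸ (LinearMap.range d₁').submoduleOf (LinearMap.ker d₂'))) := by
  obtain ⟨e₁⟩ := nonempty_torsion_homology_equiv d₁ d₂ h
  obtain ⟨e₂⟩ := nonempty_torsion_homology_equiv d₁' d₂' h'
  have hr : (LinearMap.range d₁).map (eB : B →ₗ[ℤ] B') = LinearMap.range d₁' := by
    ext y
    constructor
    · rintro ⟨_, ⟨a, rfl⟩, rfl⟩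
      exact ⟨eA a, (h₁ a).symm⟩
    · rintro ⟨a', rfl⟩
      obtain ⟨a, rfl⟩ := eA.surjective a'
      exact ⟨d₁ a, ⟨a, rfl⟩, h₁ a⟩
  obtain ⟨e₃⟩ := nonempty_torsion_equiv (Submodule.Quotient.equiv _ _ eB hr).toAddEquiv
  exact ⟨e₁.trans (e₃.trans e₂.symm)⟩

end Homology

/-! ### Homology of pieces given by incidence matrices -/

section States

variable {S S' : Type*} [Finite S] [Finite S'] {inc : S → S → ℤ} {inc' : S' → S' → ℤ}
  {P Q R : S → Prop} {P' Q' R' : S' → Prop}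

lemma stateMap_apply (f : StateChain P) (y : {x // Q x}) :
    stateMap inc P Q f y = total fun x : {x // P x} => inc x y * f x := rfl

lemma stateMap_stateMap_eq_zero
    (h : ∀ x z, P x → R z → total (fun y : {y // Q y} => inc x y * inc y z) = 0)
    (f : StateChain P) : stateMap inc Q R (stateMap inc P Q f) = 0 := by
  funext z
  rw [stateMap_apply]
  calc _ = total fun y : {y // Q y} => total fun x : {x // P x} =>
          f x * (inc x y * inc y z) := by
        congr 1
        funext y
        rw [stateMap_apply, ← total_mul_left]
        congr 1
        funext x
        ring
    _ = total fun x : {x // P x} => total fun y : {y // Q y} => f x * (inc x y * inc y z) :=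
        total_comm _
    _ = 0 := by
        simp_rw [total_mul_left, h _ _ (Subtype.prop _) z.2]
        simp [total]

/-- Matching bases give an isomorphism of chain groups that commutes with the state maps. -/
lemma stateMap_funCongrLeft (eP : {x // P' x} ≃ {x // P x}) (eQ : {x // Q' x} ≃ {x // Q x})
    (h : ∀ x y, inc (eP x) (eQ y) = inc' x y) (f : StateChain P) :
    LinearEquiv.funCongrLeft ℤ ℤ eQ (stateMap inc P Q f) =
      stateMap inc' P' Q' (LinearEquiv.funCongrLeft ℤ ℤ eP f) := by
  funext y
  change stateMap inc P Q f (eQ y) = _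
  rw [stateMap_apply, stateMap_apply]
  rw [← total_comp_of_bijective eP.bijective]
  congr 1
  funext x
  rw [h]
  rfl

lemma nonempty_stateHomology_equiv (eP : {x // P' x} ≃ {x // P x})
    (eQ : {x // Q' x} ≃ {x // Q x}) (eR : {x // R' x} ≃ {x // R x})
    (h₁ : ∀ x y, inc (eP x) (eQ y) = inc' x y) (h₂ : ∀ x y, inc (eQ x) (eR y) = inc' x y) :
    Nonempty (StateHomology inc P Q R ≃+ StateHomology inc' P' Q' R') :=
  nonempty_homology_equiv _ _ _ _ (LinearEquiv.funCongrLeft ℤ ℤ eP)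
    (LinearEquiv.funCongrLeft ℤ ℤ eQ) (LinearEquiv.funCongrLeft ℤ ℤ eR)
    (stateMap_funCongrLeft eP eQ h₁) (stateMap_funCongrLeft eQ eR h₂)

/-- The third terms need no matching bases; each pair of consecutive maps only has to compose to
zero. -/
lemma nonempty_torsion_stateHomology_equiv (eP : {x // P' x} ≃ {x // P x})
    (eQ : {x // Q' x} ≃ {x // Q x}) (h₁ : ∀ x y, inc (eP x) (eQ y) = inc' x y)
    (h : ∀ x z, P x → R z → total (fun y : {y // Q y} => inc x y * inc y z) = 0)
    (h' : ∀ x z, P' x → R' z → total (fun y : {y // Q' y} => inc' x y * inc' y z) = 0) :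
    Nonempty (AddCommGroup.torsion (StateHomology inc P Q R) ≃+
      AddCommGroup.torsion (StateHomology inc' P' Q' R')) :=
  nonempty_torsion_equiv_of_comm _ _ _ _ (LinearEquiv.funCongrLeft ℤ ℤ eP)
    (LinearEquiv.funCongrLeft ℤ ℤ eQ) (stateMap_funCongrLeft eP eQ h₁)
    (stateMap_stateMap_eq_zero h) (stateMap_stateMap_eq_zero h')

end States

/-! ### Signed incidence numbers in a cube -/

section Cube

variable {β : Type*} [LinearOrder β] {S : Type*}

open Classical in
/-- The incidence number of two states lying over the vertices `supp x` and `supp y` of a cube,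
where `step e x y` says that `y` occurs in the image of `x` under the map of the edge `e`. -/
noncomputable def cubeCoeff (supp : S → Finset β) (step : β → S → S → Prop) (x y : S) : ℤ :=
  ∑ e ∈ supp y \ supp x,
    if supp y = insert e (supp x) ∧ step e x y then
      (-1) ^ ((supp x).filter (· < e)).card
    else 0

variable {supp : S → Finset β} {step : β → S → S → Prop}

open Classical in
lemma cubeCoeff_of_insert {x y : S} {e : β} (he : e ∉ supp x) (h : supp y = insert e (supp x)) :
    cubeCoeff supp step x y =
      if step e x y then (-1) ^ ((supp x).filter (· < e)).card else 0 := by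
  have : supp y \ supp x = {e} := by
    rw [h, Finset.insert_sdiff_of_notMem _ he, Finset.sdiff_self]; rfl
  rw [cubeCoeff, this, Finset.sum_singleton]
  simp only [h, true_and]

lemma exists_of_cubeCoeff_ne_zero {x y : S} (h : cubeCoeff supp step x y ≠ 0) :
    ∃ e ∉ supp x, supp y = insert e (supp x) ∧ step e x y := by
  obtain ⟨e, he, hne⟩ := Finset.exists_ne_zero_of_sum_ne_zero h
  refine ⟨e, (Finset.mem_sdiff.1 he).2, ?_⟩
  by_contra hc
  exact hne (if_neg hc)

lemma cubeCoeff_eq_of_iff {S' : Type*} {supp' : S' → Finset β} {step' : β → S' → S' → Prop}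
    {x y : S} {x' y' : S'} (hx : supp' x' = supp x) (hy : supp' y' = supp y)
    (h : ∀ e ∉ supp x, supp y = insert e (supp x) → (step' e x' y' ↔ step e x y)) :
    cubeCoeff supp' step' x' y' = cubeCoeff supp step x y := by
  unfold cubeCoeff
  rw [hx, hy]
  refine Finset.sum_congr rfl fun e he => ?_
  congr 1
  rw [eq_iff_iff]
  exact and_congr_right fun h1 => h e (Finset.mem_sdiff.1 he).2 h1

/-- Inserting the smaller edge first raises the sign exponent of the larger by one; inserting the
larger first leaves that of the smaller unchanged. -/
lemma cube_sign_cancel {s : Finset β} {e f : β} (he : e ∉ s) (hf : f ∉ s) (hef : e ≠ f) :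
    (-1 : ℤ) ^ (s.filter (· < e)).card * (-1) ^ ((insert e s).filter (· < f)).card +
      (-1) ^ (s.filter (· < f)).card * (-1) ^ ((insert f s).filter (· < e)).card = 0 := by
  wlog h : e < f generalizing e f
  · rw [add_comm]
    exact this hf he hef.symm (lt_of_le_of_ne (not_lt.1 h) hef.symm)
  rw [Finset.filter_insert, Finset.filter_insert, if_pos h, if_neg h.not_gt,
    Finset.card_insert_of_notMem (by simp [he])]
  ring

/-- `d² = 0` at the matrix entry `(x, z)`: it suffices that the two ways around each square have
the same intermediate states. -/
lemma total_cubeCoeff_mul_eq_zero [Finite S] {Q : S → Prop} (x z : S)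
    (hQ : ∀ e y, e ∉ supp x → supp y = insert e (supp x) → step e x y → Q y)
    (huniq : ∀ e y y', e ∉ supp x → supp y = insert e (supp x) → supp y' = insert e (supp x) →
      step e x y → step e x y' → y = y')
    (hex : ∀ e f y, e ∉ supp x → f ∉ supp x → e ≠ f → supp y = insert e (supp x) →
      supp z = insert f (supp y) → step e x y → step f y z →
      ∃ y', supp y' = insert f (supp x) ∧ supp z = insert e (supp y') ∧
        step f x y' ∧ step e y' z) :
    total (fun y : {y // Q y} => cubeCoeff supp step x y * cubeCoeff supp step y z) = 0 := by
  classical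
  by_cases hall : ∀ y : {y // Q y}, cubeCoeff supp step x y * cubeCoeff supp step y z = 0
  · simp [total, hall]
  push Not at hall
  obtain ⟨⟨y, hy⟩, hne⟩ := hall
  obtain ⟨e, he, hye, hse⟩ := exists_of_cubeCoeff_ne_zero (left_ne_zero_of_mul hne)
  obtain ⟨f, hf, hzf, hsf⟩ := exists_of_cubeCoeff_ne_zero (right_ne_zero_of_mul hne)
  dsimp only at hye hse hf hzf hsf
  have hef : e ≠ f := by rintro rfl; exact hf (by rw [hye]; exact Finset.mem_insert_self _ _)
  have hfx : f ∉ supp x := fun h => hf (by rw [hye]; exact Finset.mem_insert_of_mem h)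
  obtain ⟨y', hy'f, hze, hsf', hse'⟩ := hex e f y he hfx hef hye hzf hse hsf
  have hey' : e ∉ supp y' := by rw [hy'f]; simp [hef, he]
  have hy' : Q y' := hQ f y' hfx hy'f hsf'
  have hyy' : y ≠ y' := by
    rintro rfl
    exact hey' (by rw [hye]; exact Finset.mem_insert_self _ _)
  -- Any contributing state lies over `supp x` with `e` or `f` added, and uniqueness identifies it
  -- with `y` or `y'`.
  rw [total_of_support_subset_pair (x := ⟨y, hy⟩) (y := ⟨y', hy'⟩) (by simpa using hyy')]
  · dsimp only
    rw [cubeCoeff_of_insert he hye, cubeCoeff_of_insert hf hzf, cubeCoeff_of_insert hfx hy'f,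
      cubeCoeff_of_insert hey' hze, if_pos hse, if_pos hsf, if_pos hsf', if_pos hse', hye, hy'f]
    exact cube_sign_cancel he hfx hef
  · rintro ⟨w, hw⟩ hw1 hw2
    by_contra hne'
    obtain ⟨g, hg, hwg, hsg⟩ := exists_of_cubeCoeff_ne_zero (left_ne_zero_of_mul hne')
    obtain ⟨g', -, hzg, -⟩ := exists_of_cubeCoeff_ne_zero (right_ne_zero_of_mul hne')
    dsimp only at hwg hsg hzg
    have hgz : g ∈ supp z := by rw [hzg, hwg]; simp
    rw [hzf, hye] at hgz
    simp only [Finset.mem_insert] at hgz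
    rcases hgz with rfl | rfl | hgz
    · exact hw2 (Subtype.ext (huniq g w y' hg hwg hy'f hsg hsf'))
    · exact hw1 (Subtype.ext (huniq g w y hg hwg hye hsg hse))
    · exact hg hgz

end Cube

/-! ### Components of spanning subgraphs -/

namespace Graph

variable {α β : Type*} {G : Graph α β}

lemma spanningComponent_surjective (s : Finset β) :
    Function.Surjective (G.spanningComponent s) := Quot.mk_surjective

lemma spanningComponent_eq_of_isLink {s : Finset β} {e : β} (he : e ∈ s) {u v : G.vertexSet}
    (h : G.IsLink e u v) : G.spanningComponent s u = G.spanningComponent s v :=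
  Quot.sound ⟨e, by simpa [restrict_isLink] using ⟨he, h⟩⟩

/-- To identify components it suffices to identify the ends of each edge. -/
lemma spanningComponent_induction {s : Finset β} {r : G.vertexSet → G.vertexSet → Prop}
    (hr : Equivalence r) (hlink : ∀ e ∈ s, ∀ u v : G.vertexSet, G.IsLink e u v → r u v)
    {u v : G.vertexSet} (h : G.spanningComponent s u = G.spanningComponent s v) : r u v := by
  have h' := Quot.eqvGen_exact h
  clear h
  induction h' with
  | rel x y h =>
    obtain ⟨e, he⟩ := h
    rw [restrict_isLink] at he
    exact hlink e (by simpa using he.1) x y he.2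
  | refl x => exact hr.refl x
  | symm x y _ ih => exact hr.symm ih
  | trans x y z _ _ ih₁ ih₂ => exact hr.trans ih₁ ih₂

lemma spanningComponent_empty_injective : Function.Injective (G.spanningComponent ∅) :=
  fun _ _ h => spanningComponent_induction (r := fun u v => u = v) eq_equivalence (by simp) h

lemma spanningComponent_mono {s t : Finset β} (hst : s ⊆ t) {u v : G.vertexSet}
    (h : G.spanningComponent s u = G.spanningComponent s v) :
    G.spanningComponent t u = G.spanningComponent t v :=
  spanningComponent_induction (r := fun u v => G.spanningComponent t u = G.spanningComponent t v)
    ⟨fun _ => rfl, Eq.symm, Eq.trans⟩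
    (fun _ he _ _ hl => spanningComponent_eq_of_isLink (hst he) hl) h

/-- The map on components induced by an inclusion of edge sets. -/
def componentMap (G : Graph α β) {s t : Finset β} (hst : s ⊆ t) :
    G.SpanningComponent s → G.SpanningComponent t :=
  Quot.lift (G.spanningComponent t) fun _ _ h => spanningComponent_mono hst (Quot.sound h)

@[simp]
lemma componentMap_spanningComponent {s t : Finset β} (hst : s ⊆ t) (v : G.vertexSet) :
    G.componentMap hst (G.spanningComponent s v) = G.spanningComponent t v := rfl

lemma componentMap_surjective {s t : Finset β} (hst : s ⊆ t) :
    Function.Surjective (G.componentMap hst) := by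
  intro c
  obtain ⟨v, rfl⟩ := spanningComponent_surjective t c
  exact ⟨G.spanningComponent s v, rfl⟩

lemma componentMap_componentMap {s t w : Finset β} (hst : s ⊆ t) (htw : t ⊆ w)
    (c : G.SpanningComponent s) :
    G.componentMap htw (G.componentMap hst c) = G.componentMap (hst.trans htw) c := by
  obtain ⟨v, rfl⟩ := spanningComponent_surjective s c
  rfl

section Insert

variable [DecidableEq β] {s t : Finset β} {e : β} {u v : G.vertexSet}

/-- The right-hand side is an equivalence relation containing the links of `insert e s`, so it
contains the relation they generate. It has the same shape as `sameCycle_mul_swap_iff`, which lets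
circles and components be compared inductively. -/
lemma spanningComponent_insert_eq_iff (h : G.IsLink e u v) (ht : t = insert e s)
    (a b : G.vertexSet) :
    G.spanningComponent t a = G.spanningComponent t b ↔
      G.spanningComponent s a = G.spanningComponent s b ∨
      ((G.spanningComponent s a = G.spanningComponent s u ∨
          G.spanningComponent s a = G.spanningComponent s v) ∧
        (G.spanningComponent s b = G.spanningComponent s u ∨
          G.spanningComponent s b = G.spanningComponent s v)) := by
  subst ht
  have hst : s ⊆ insert e s := Finset.subset_insert _ _
  have huv := spanningComponent_eq_of_isLink (Finset.mem_insert_self e s) h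
  constructor
  · refine spanningComponent_induction (r := fun a b =>
      G.spanningComponent s a = G.spanningComponent s b ∨
      ((G.spanningComponent s a = G.spanningComponent s u ∨
          G.spanningComponent s a = G.spanningComponent s v) ∧
        (G.spanningComponent s b = G.spanningComponent s u ∨
          G.spanningComponent s b = G.spanningComponent s v)))
      ⟨by grind, by grind, by grind⟩ ?_
    intro f hf a b hl
    rcases Finset.mem_insert.1 hf with rfl | hf
    · rcases hl.eq_and_eq_or_eq_and_eq h with ⟨h1, h2⟩ | ⟨h1, h2⟩
      · rw [Subtype.ext h1, Subtype.ext h2]; simp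
      · rw [Subtype.ext h1, Subtype.ext h2]; simp
    · exact Or.inl (spanningComponent_eq_of_isLink hf hl)
  · have m : ∀ {a b}, G.spanningComponent s a = G.spanningComponent s b →
        G.spanningComponent (insert e s) a = G.spanningComponent (insert e s) b :=
      spanningComponent_mono hst
    rintro (h1 | ⟨h1 | h1, h2 | h2⟩)
    · exact m h1
    · exact (m h1).trans (m h2).symm
    · exact (m h1).trans (huv.trans (m h2).symm)
    · exact (m h1).trans (huv.symm.trans (m h2).symm)
    · exact (m h1).trans (m h2).symm

lemma isMerge_componentMap (h : G.IsLink e u v) (ht : t = insert e s) (hst : s ⊆ t)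
    (hne : G.spanningComponent s u ≠ G.spanningComponent s v) :
    IsMerge (G.componentMap hst) (G.spanningComponent s u) (G.spanningComponent s v) where
  surj := componentMap_surjective hst
  ne := hne
  eq_iff a b := by
    obtain ⟨a, rfl⟩ := spanningComponent_surjective s a
    obtain ⟨b, rfl⟩ := spanningComponent_surjective s b
    exact spanningComponent_insert_eq_iff h ht a b

lemma spanningComponent_insert_eq_iff_of_eq (h : G.IsLink e u v) (ht : t = insert e s)
    (heq : G.spanningComponent s u = G.spanningComponent s v) (a b : G.vertexSet) :
    G.spanningComponent t a = G.spanningComponent t b ↔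
      G.spanningComponent s a = G.spanningComponent s b := by
  rw [spanningComponent_insert_eq_iff h ht, heq]
  grind

lemma componentMap_bijective (h : G.IsLink e u v) (ht : t = insert e s) (hst : s ⊆ t)
    (heq : G.spanningComponent s u = G.spanningComponent s v) :
    Function.Bijective (G.componentMap hst) := by
  refine ⟨?_, componentMap_surjective hst⟩
  intro a b hab
  obtain ⟨a, rfl⟩ := spanningComponent_surjective s a
  obtain ⟨b, rfl⟩ := spanningComponent_surjective s b
  exact (spanningComponent_insert_eq_iff_of_eq h ht heq a b).1 hab

end Insert

/-! #### The girth -/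

/-- An edge whose ends are already connected by `s` closes a cycle. -/
lemma girth_le_of_spanningComponent_eq {s : Finset β} {e : β} (he : e ∉ s) {u v : G.vertexSet}
    (h : G.IsLink e u v) (huv : G.spanningComponent s u = G.spanningComponent s v) :
    G.girth ≤ s.card + 1 := by
  classical
  -- Loops and multiplicities are irrelevant for connectivity, so a path can be taken in a simple
  -- graph and its edges lifted to `s`.
  let H : SimpleGraph G.vertexSet :=
    SimpleGraph.fromRel fun a b => ∃ f ∈ s, G.IsLink f a b
  have hadj : ∀ a b, H.Adj a b → ∃ f ∈ s, G.IsLink f a b := by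
    rintro a b ⟨-, ⟨f, hf, hl⟩ | ⟨f, hf, hl⟩⟩
    · exact ⟨f, hf, hl⟩
    · exact ⟨f, hf, hl.symm⟩
  have hreach : H.Reachable u v := by
    refine spanningComponent_induction (r := fun a b => H.Reachable a b)
      ⟨fun a => .refl a, .symm, .trans⟩ ?_ huv
    intro f hf a b hl
    by_cases hab : a = b
    · rw [hab]
    · exact SimpleGraph.Adj.reachable ⟨hab, Or.inl ⟨f, hf, hl⟩⟩
  obtain ⟨p, hp⟩ := hreach.symm.exists_isPath
  set n := p.length with hn
  have hinj := hp.getVert_injOn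
  have : Nonempty β := ⟨e⟩
  choose! f hfs hfl using hadj
  -- The path runs from `v` to `u`, so `e` closes it up at the last index `n`, where `k + 1` wraps
  -- around to `0`.
  let E : Fin (n + 1) → β := fun k =>
    if (k : ℕ) = n then e else f (p.getVert k) (p.getVert (k + 1))
  have hE : ∀ k : Fin (n + 1), (k : ℕ) ≠ n → E k ∈ s ∧
      G.IsLink (E k) (p.getVert k) (p.getVert (k + 1)) := by
    intro k hk
    have := p.adj_getVert_succ (i := k) (by have := k.2; omega)
    simp only [E, if_neg hk]
    exact ⟨hfs _ _ this, hfl _ _ this⟩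
  have hEn : ∀ k : Fin (n + 1), (k : ℕ) = n → E k = e := fun k hk => if_pos hk
  have hEinj : Function.Injective E := by
    intro k l hkl
    by_cases hk : (k : ℕ) = n <;> by_cases hl : (l : ℕ) = n
    · exact Fin.ext (hk.trans hl.symm)
    · rw [hEn k hk] at hkl; exact absurd (hkl ▸ (hE l hl).1) he
    · rw [hEn l hl] at hkl; exact absurd (hkl ▸ (hE k hk).1) he
    · have h1 := (hE k hk).2
      have h2 := (hE l hl).2
      rw [hkl] at h1
      have hk2 := k.2
      have hl2 := l.2
      rcases h1.eq_and_eq_or_eq_and_eq h2 with ⟨h3, -⟩ | ⟨h3, h4⟩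
      · exact Fin.ext (hinj (by simp; omega) (by simp; omega) (Subtype.ext h3))
      -- Traversing the same edge in the opposite direction would require both `k = l + 1` and `k +
      -- 1 = l`.
      · have h5 := hinj (by simp; omega) (by simp; omega) (Subtype.ext h3)
        have h6 := hinj (by simp; omega) (by simp; omega) (Subtype.ext h4)
        omega
  have hcyc : G.HasCycleOfLength (n + 1) := by
    refine ⟨inferInstance, fun k => p.getVert k, E, ?_, hEinj, ?_⟩
    · intro k l hkl
      have hk2 := k.2
      have hl2 := l.2
      exact Fin.ext (hinj (by simp; omega) (by simp; omega) (Subtype.ext hkl))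
    · intro k
      by_cases hk : (k : ℕ) = n
      · have hk' : k = Fin.last n := Fin.ext hk
        subst hk'
        rw [hEn _ hk]
        simpa [hn] using h
      · have hv : ((k + 1 : Fin (n + 1)) : ℕ) = k + 1 := by
          apply Fin.val_add_one_of_lt
          rw [Fin.lt_def, Fin.val_last]
          have := k.2
          omega
        change G.IsLink (E k) (p.getVert k) (p.getVert ((k + 1 : Fin (n + 1)) : ℕ))
        rw [hv]
        exact (hE k hk).2
  have hcard : n + 1 ≤ s.card + 1 := by
    have hmaps : ∀ k : Fin (n + 1), E k ∈ insert e s := by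
      intro k
      by_cases hk : (k : ℕ) = n
      · rw [hEn k hk]; exact Finset.mem_insert_self _ _
      · exact Finset.mem_insert_of_mem (hE k hk).1
    have := Finset.card_le_card_of_injOn (s := Finset.univ) (t := insert e s) E
      (fun k _ => hmaps k) hEinj.injOn
    simpa [Finset.card_insert_of_notMem he] using this
  refine (iInf₂_le (n + 1) hcyc).trans ?_
  exact_mod_cast hcard

lemma spanningComponent_ne_of_card_lt_girth {s : Finset β} {e : β} (he : e ∉ s)
    {u v : G.vertexSet} (h : G.IsLink e u v) (hs : (s.card : ℕ∞) + 1 < G.girth) :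
    G.spanningComponent s u ≠ G.spanningComponent s v :=
  fun huv => hs.not_ge (girth_le_of_spanningComponent_eq he h huv)

/-- A spanning forest with `k` edges has `V - k` components. -/
lemma card_spanningComponent [Finite α] [DecidableEq β] {s : Finset β}
    (hsub : (s : Set β) ⊆ G.edgeSet) (hs : (s.card : ℕ∞) < G.girth) :
    (Nat.card (G.SpanningComponent s) : ℤ) = G.vertexSet.ncard - s.card := by
  induction s using Finset.induction_on with
  | empty =>
    have := Nat.card_congr (Equiv.ofBijective _
      ⟨spanningComponent_empty_injective (G := G), spanningComponent_surjective ∅⟩)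
    rw [← this, Finset.card_empty, Nat.card_coe_set_eq]
    simp
  | insert e s he ih =>
    rw [Finset.card_insert_of_notMem he] at hs ⊢
    obtain ⟨x, y, hxy⟩ := (G.edge_mem_iff_exists_isLink e).1 (hsub (by simp))
    have hm := (isMerge_componentMap (u := ⟨x, hxy.left_mem⟩) (v := ⟨y, hxy.right_mem⟩) hxy rfl
      (Finset.subset_insert e s)
      (spanningComponent_ne_of_card_lt_girth he hxy (by exact_mod_cast hs))).card_eq
    rw [ih ((Finset.coe_subset.2 (Finset.subset_insert e s)).trans hsub)
      (lt_of_le_of_lt (by exact_mod_cast Nat.le_succ _) hs)] at hm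
    push_cast
    linarith

/-! #### The differential in terms of sums over fibres -/

namespace EnhancedState

/-- The labels as integers. -/
def intLabel (S : G.EnhancedState) (c : G.SpanningComponent S.edges) : ℤ := ((S.label c : ℕ) : ℤ)

lemma intLabel_nonneg (S : G.EnhancedState) (c : G.SpanningComponent S.edges) :
    0 ≤ S.intLabel c := by simp [intLabel]

lemma intLabel_le_one (S : G.EnhancedState) (c : G.SpanningComponent S.edges) :
    S.intLabel c ≤ 1 := by
  have := (S.label c).2
  simp only [intLabel]
  omega

lemma intLabel_eq_iff {S T : G.EnhancedState} {c : G.SpanningComponent S.edges}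
    {d : G.SpanningComponent T.edges} : S.intLabel c = T.intLabel d ↔ S.label c = T.label d := by
  simp [intLabel, Fin.ext_iff]

variable [Finite α] [DecidableEq β] {S T : G.EnhancedState} {e : β}

/-- Multiplication adds exponents, and an edge inside a component makes the map on components
bijective, so both cases become one equation. It does not mention the chosen ends of `e`. -/
lemma labelStep_iff (h : T.edges = insert e S.edges)
    (hst : S.edges ⊆ T.edges) :
    LabelStep e S T ↔ T.intLabel = fiberSum (G.componentMap hst) S.intLabel := by
  have key : ∀ u v : G.vertexSet, G.IsLink e u v →
      (((G.spanningComponent S.edges u = G.spanningComponent S.edges v ∧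
        ∀ w, T.label (G.spanningComponent T.edges w) = S.label (G.spanningComponent S.edges w)) ∨
      (G.spanningComponent S.edges u ≠ G.spanningComponent S.edges v ∧
        (T.label (G.spanningComponent T.edges u) : ℕ) =
          (S.label (G.spanningComponent S.edges u) : ℕ) +
            (S.label (G.spanningComponent S.edges v) : ℕ) ∧
        ∀ w, G.spanningComponent S.edges w ≠ G.spanningComponent S.edges u →
          G.spanningComponent S.edges w ≠ G.spanningComponent S.edges v →
          T.label (G.spanningComponent T.edges w) = S.label (G.spanningComponent S.edges w))) ↔
      T.intLabel = fiberSum (G.componentMap hst) S.intLabel) := by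
    intro u v hl
    by_cases huv : G.spanningComponent S.edges u = G.spanningComponent S.edges v
    · rw [eq_fiberSum_of_bijective_iff (componentMap_bijective hl h hst huv),
        (spanningComponent_surjective S.edges).forall]
      simp [huv, intLabel_eq_iff]
    · have hm := isMerge_componentMap hl h hst huv
      rw [hm.eq_fiberSum_iff, (spanningComponent_surjective S.edges).forall]
      simp only [huv, false_and, false_or, ne_eq, not_false_eq_true, true_and, intLabel_eq_iff,
        componentMap_spanningComponent]
      rw [and_comm]
      refine and_congr_right fun _ => ?_
      simp only [intLabel]
      exact_mod_cast Iff.rfl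
  constructor
  · rintro ⟨u, v, hl, hstep⟩
    exact (key u v hl).1 hstep
  · intro hstep
    have hmem : e ∈ G.edgeSet := T.edges_subset (by simp [h])
    obtain ⟨x, y, hxy⟩ := (G.edge_mem_iff_exists_isLink e).1 hmem
    exact ⟨⟨x, hxy.left_mem⟩, ⟨y, hxy.right_mem⟩, hxy, (key _ _ hxy).2 hstep⟩

lemma degree_eq_total (S : G.EnhancedState) : (S.degree : ℤ) = total S.intLabel := by
  classical
  let _ := Fintype.ofFinite (G.SpanningComponent S.edges)
  rw [degree, Nat.card_eq_fintype_card, Fintype.card_subtype, total_eq_sum, Finset.card_filter]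
  push_cast
  refine Finset.sum_congr rfl fun c _ => ?_
  simp only [intLabel]
  generalize S.label c = a
  fin_cases a <;> simp

end EnhancedState

end Graph

/-! ### Circles as cycles of a permutation of the even ends -/

namespace LinkDiagram

variable {X L : Type*}

/-- The ends of the understrands. -/
abbrev EvenEnd (X : Type*) : Type _ := {d : X × Fin 4 // (d.2 : ℕ) % 2 = 0}

/-- The end `(c, 0)`. -/
def endZero (c : X) : EvenEnd X := ⟨(c, 0), rfl⟩

/-- The end `(c, 2)`. -/
def endTwo (c : X) : EvenEnd X := ⟨(c, 2), (by decide : ((2 : Fin 4) : ℕ) % 2 = 0)⟩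

lemma endZero_ne_endTwo (c : X) : endZero c ≠ endTwo c :=
  fun h => absurd (congrArg (fun d : EvenEnd X => d.1.2) h) (by decide : (0 : Fin 4) ≠ 2)

lemma EvenEnd.eq_endZero_or_eq_endTwo (d : EvenEnd X) : d = endZero d.1.1 ∨ d = endTwo d.1.1 := by
  obtain ⟨⟨c, k⟩, hk⟩ := d
  have : k = 0 ∨ k = 2 := by
    have hk' : (k : ℕ) % 2 = 0 := hk
    clear hk
    revert k
    decide
  exact this.imp (fun h => Subtype.ext (congrArg (Prod.mk c) h))
    fun h => Subtype.ext (congrArg (Prod.mk c) h)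

section Smoothing

variable [DecidableEq X]

/-- The other end of the strand of the smoothing at a crossing. -/
def smoothing (s : Finset X) (d : X × Fin 4) : X × Fin 4 := (d.1, smoothEnd (d.1 ∈ s) d.2)

lemma smoothing_smoothing (s : Finset X) (d : X × Fin 4) : smoothing s (smoothing s d) = d := by
  obtain ⟨c, k⟩ := d
  by_cases h : c ∈ s <;> fin_cases k <;> simp [smoothing, smoothEnd, h]

lemma smoothing_parity (s : Finset X) (d : X × Fin 4) :
    ((smoothing s d).2 : ℕ) % 2 ≠ (d.2 : ℕ) % 2 := by
  obtain ⟨c, k⟩ := d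
  by_cases h : c ∈ s <;> fin_cases k <;> simp [smoothing, smoothEnd, h]

lemma circleAt_arc (D : LinkDiagram X L) (s : Finset X) (d : X × Fin 4) :
    D.circleAt s (D.arc d) = D.circleAt s d :=
  congrArg Sum.inl (Quot.sound (r := D.SmoothAdj s) (Or.inl rfl)).symm

lemma circleAt_smoothing (D : LinkDiagram X L) (s : Finset X) (d : X × Fin 4) :
    D.circleAt s (smoothing s d) = D.circleAt s d :=
  congrArg Sum.inl (Quot.sound (r := D.SmoothAdj s) (Or.inr rfl)).symm

variable {D : LinkDiagram X L} (hD : D.IsAlternating)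

/-- Walking along the circles of a smoothing of an alternating diagram. -/
def circlePerm (s : Finset X) : Equiv.Perm (EvenEnd X) where
  toFun d := ⟨D.arc (smoothing s d), by
    have h1 := hD (smoothing s d)
    have h2 := smoothing_parity s d
    have h3 := d.2
    omega⟩
  invFun d := ⟨smoothing s (D.arc d), by
    have h1 := hD d
    have h2 := smoothing_parity s (D.arc d)
    have h3 := d.2
    omega⟩
  left_inv d := Subtype.ext (by simp only [D.arc_arc, smoothing_smoothing])
  right_inv d := Subtype.ext (by simp only [D.arc_arc, smoothing_smoothing])

lemma circlePerm_apply_coe (s : Finset X) (d : EvenEnd X) :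
    (circlePerm hD s d : X × Fin 4) = D.arc (smoothing s d) := rfl

/-- The `0`-marker sends `0 ↦ 1`, `2 ↦ 3` and the `1`-marker sends `0 ↦ 3`, `2 ↦ 1`: they differ by
exchanging the even ends. -/
lemma circlePerm_insert {s t : Finset X} {c : X} (hc : c ∉ s) (ht : t = insert c s) :
    circlePerm hD t = circlePerm hD s * Equiv.swap (endZero c) (endTwo c) := by
  subst ht
  ext1 d
  rw [Equiv.Perm.mul_apply]
  apply Subtype.ext
  rw [circlePerm_apply_coe, circlePerm_apply_coe]
  congr 1
  by_cases h : d.1.1 = c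
  · rcases d.eq_endZero_or_eq_endTwo with h' | h'
    · rw [h', h, Equiv.swap_apply_left]
      simp [smoothing, smoothEnd, hc, endZero, endTwo]
    · rw [h', h, Equiv.swap_apply_right]
      simp [smoothing, smoothEnd, hc, endZero, endTwo]
  · rw [Equiv.swap_apply_of_ne_of_ne]
    · simp [smoothing, h]
    · rintro rfl; exact h rfl
    · rintro rfl; exact h rfl

/-- Two ends lie on the same circle if and only if walking along the circle leads from one to the
other. -/
lemma circleAt_eq_iff [Finite X] (s : Finset X) (a b : EvenEnd X) :
    D.circleAt s a = D.circleAt s b ↔ (circlePerm hD s).SameCycle a b := by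
  constructor
  · intro h
    -- By alternation every arc has exactly one even end. Moving each end to it carries the
    -- generating adjacencies to steps of the permutation.
    let ev : X × Fin 4 → EvenEnd X := fun d =>
      if h : (d.2 : ℕ) % 2 = 0 then ⟨d, h⟩ else ⟨D.arc d, by have := hD d; omega⟩
    have hev : ∀ d : EvenEnd X, ev d = d := fun d => dif_pos d.2
    have hodd : ∀ (d : X × Fin 4) (h : ¬ (d.2 : ℕ) % 2 = 0), (ev d : X × Fin 4) = D.arc d := by
      intro d h
      simp only [ev, dif_neg h]
    have harc : ∀ d, ev (D.arc d) = ev d := by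
      intro d
      have h1 := hD d
      by_cases hd : (d.2 : ℕ) % 2 = 0
      · apply Subtype.ext
        rw [hodd _ (by omega), D.arc_arc, hev ⟨d, hd⟩]
      · apply Subtype.ext
        rw [hodd _ hd, hev ⟨D.arc d, by omega⟩]
    have hsm : ∀ d : EvenEnd X, ev (smoothing s d) = circlePerm hD s d := by
      intro d
      rw [← harc, ← circlePerm_apply_coe hD, hev]
    have hall : ∀ d, (circlePerm hD s).SameCycle (ev d) (ev (smoothing s d)) := by
      intro d
      by_cases hd : (d.2 : ℕ) % 2 = 0
      · rw [hev ⟨d, hd⟩, hsm ⟨d, hd⟩]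
        exact Equiv.Perm.sameCycle_apply_right.2 (Equiv.Perm.SameCycle.refl _ _)
      · have h2 := smoothing_parity s d
        have h3 := hsm ⟨smoothing s d, by omega⟩
        simp only [smoothing_smoothing] at h3
        rw [h3, hev ⟨smoothing s d, by omega⟩]
        exact Equiv.Perm.sameCycle_apply_left.2 (Equiv.Perm.SameCycle.refl _ _)
    have key : ∀ d d', Relation.EqvGen (D.SmoothAdj s) d d' →
        (circlePerm hD s).SameCycle (ev d) (ev d') := by
      intro d d' hdd
      induction hdd with
      | rel d d' h =>
        rcases h with rfl | rfl
        · rw [harc]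
        · exact hall d
      | refl d => exact Equiv.Perm.SameCycle.refl _ _
      | symm _ _ _ ih => exact ih.symm
      | trans _ _ _ _ _ ih₁ ih₂ => exact ih₁.trans ih₂
    have := key a b (Quot.eqvGen_exact (Sum.inl_injective h))
    rwa [hev, hev] at this
  · intro h
    refine (h.mem_of_forward (p := fun z : EvenEnd X => D.circleAt s a = D.circleAt s z) rfl ?_)
    intro z _ hz
    rw [circlePerm_apply_coe, circleAt_arc, circleAt_smoothing, hz]

end Smoothing

/-! #### Circles and components -/

/-- Places on a diagram: the even strand ends and the components without crossings. -/
abbrev Place (X L : Type*) : Type _ := EvenEnd X ⊕ L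

lemma isShaded_face (D : LinkDiagram X L) (d : EvenEnd X) : D.IsShaded (D.face d) := by
  refine ⟨d.1.1, ?_⟩
  rcases d.eq_endZero_or_eq_endTwo with h | h
  · exact Or.inl (congrArg (fun d : EvenEnd X => D.face d) h)
  · exact Or.inr (congrArg (fun d : EvenEnd X => D.face d) h)

/-- The vertex of the Tait graph next to a place. -/
def vertexAt (D : LinkDiagram X L) : Place X L → D.taitGraph.vertexSet
  | Sum.inl d => ⟨Sum.inl ⟨D.face d, D.isShaded_face d⟩, trivial⟩
  | Sum.inr l => ⟨Sum.inr l, trivial⟩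

lemma vertexAt_surjective (D : LinkDiagram X L) : Function.Surjective D.vertexAt := by
  rintro ⟨⟨_, c, rfl | rfl⟩ | l, -⟩
  · exact ⟨Sum.inl (endZero c), rfl⟩
  · exact ⟨Sum.inl (endTwo c), rfl⟩
  · exact ⟨Sum.inr l, rfl⟩

lemma isLink_vertexAt (D : LinkDiagram X L) (c : X) :
    D.taitGraph.IsLink c (D.vertexAt (Sum.inl (endZero c))) (D.vertexAt (Sum.inl (endTwo c))) :=
  rfl

/-- The component of the spanning subgraph next to a place. -/
def componentAt (D : LinkDiagram X L) (s : Finset X) (w : Place X L) :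
    D.taitGraph.SpanningComponent s := D.taitGraph.spanningComponent s (D.vertexAt w)

lemma componentAt_surjective (D : LinkDiagram X L) (s : Finset X) :
    Function.Surjective (D.componentAt s) :=
  (Graph.spanningComponent_surjective s).comp D.vertexAt_surjective

lemma face_nextCorner (D : LinkDiagram X L) (d : X × Fin 4) :
    D.face (D.nextCorner d) = D.face d :=
  (Quot.sound (r := fun d d' : X × Fin 4 => d' = D.nextCorner d) rfl).symm

variable [DecidableEq X]

/-- The circle of a smoothing through a place. -/
def circleOf (D : LinkDiagram X L) (s : Finset X) : Place X L → D.Circle s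
  | Sum.inl d => D.circleAt s d
  | Sum.inr l => Sum.inr l

variable {D : LinkDiagram X L} (hD : D.IsAlternating)
include hD

lemma exists_evenEnd_circleAt (d : X × Fin 4) :
    ∃ a : EvenEnd X, ∀ s, D.circleAt s d = D.circleAt s a := by
  by_cases h : (d.2 : ℕ) % 2 = 0
  · exact ⟨⟨d, h⟩, fun _ => rfl⟩
  · have := hD d
    exact ⟨⟨D.arc d, by omega⟩, fun t => (D.circleAt_arc t d).symm⟩

lemma circleOf_surjective (s : Finset X) : Function.Surjective (D.circleOf s) := by
  rintro (d | l)
  · induction d using Quot.ind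
    obtain ⟨a, ha⟩ := exists_evenEnd_circleAt hD ‹_›
    exact ⟨Sum.inl a, (ha s).symm⟩
  · exact ⟨Sum.inr l, rfl⟩

variable [Finite X]

/-- One step along a circle stays at the same shaded face at a `0`-marker, and passes to the face at
the opposite shaded corner at a `1`-marker; these two faces are joined by the edge `c ∈ s`. No bound
on `s` is needed. -/
lemma componentAt_eq_of_circleOf_eq (s : Finset X) {w w' : Place X L}
    (h : D.circleOf s w = D.circleOf s w') : D.componentAt s w = D.componentAt s w' := by
  rcases w with a | l <;> rcases w' with b | l'
  · have hc := (circleAt_eq_iff hD s a b).1 h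
    refine hc.mem_of_forward
      (p := fun b => D.componentAt s (Sum.inl a) = D.componentAt s (Sum.inl b)) rfl ?_
    intro z _ hz
    rw [hz]
    have hf : ∀ z z' : EvenEnd X, D.face z = D.face z' →
        D.componentAt s (Sum.inl z) = D.componentAt s (Sum.inl z') := by
      intro z z' hzz
      unfold componentAt
      congr 1
      exact Subtype.ext (congrArg Sum.inl (Subtype.ext hzz))
    have hlink : z.1.1 ∈ s → D.componentAt s (Sum.inl (endZero z.1.1)) =
        D.componentAt s (Sum.inl (endTwo z.1.1)) := fun hc =>
      Graph.spanningComponent_eq_of_isLink hc (D.isLink_vertexAt _)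
    set c := z.1.1 with hc
    rcases z.eq_endZero_or_eq_endTwo with h' | h' <;> rw [← hc] at h' <;> rw [h'] <;>
      by_cases hcs : c ∈ s
    · rw [hlink hcs]
      apply hf
      rw [← face_nextCorner]
      simp [circlePerm_apply_coe, smoothing, smoothEnd, hcs, endZero, endTwo,
        DiagramData.nextCorner]
    · apply hf
      rw [← face_nextCorner]
      simp [circlePerm_apply_coe, smoothing, smoothEnd, hcs, endZero,
        DiagramData.nextCorner]
    · rw [← hlink hcs]
      apply hf
      rw [← face_nextCorner]
      simp [circlePerm_apply_coe, smoothing, smoothEnd, hcs, endZero, endTwo,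
        DiagramData.nextCorner]
    · apply hf
      rw [← face_nextCorner]
      simp [circlePerm_apply_coe, smoothing, smoothEnd, hcs, endTwo,
        DiagramData.nextCorner]
  · cases h
  · cases h
  · cases h; rfl

/-- With only `0`-markers the circles run around the shaded faces: on even corners, `nextCorner` is
one step of the smoothing followed by an arc. -/
lemma circleOf_empty_eq {w w' : Place X L} (h : D.vertexAt w = D.vertexAt w') :
    D.circleOf ∅ w = D.circleOf ∅ w' := by
  rcases w with a | l <;> rcases w' with b | l'
  · have hf : D.face a = D.face b := by
      have h1 := Sum.inl_injective (congrArg Subtype.val h)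
      exact congrArg Subtype.val h1
    -- Faces are classes of all corners, so the invariant needs a value on odd ones; `none` works
    -- because `nextCorner` preserves parity.
    let g : X × Fin 4 → Option (D.Circle ∅) := fun d =>
      if (d.2 : ℕ) % 2 = 0 then some (D.circleAt ∅ d) else none
    have hg : ∀ d, g (D.nextCorner d) = g d := by
      intro d
      have h1 := hD (d.1, d.2 + 1)
      have h2 : ((d.2 + 1 : Fin 4) : ℕ) % 2 ≠ (d.2 : ℕ) % 2 := by
        generalize d.2 = k
        fin_cases k <;> simp
      by_cases hd : (d.2 : ℕ) % 2 = 0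
      · have h3 : ((D.nextCorner d).2 : ℕ) % 2 = 0 := by
          simp only [DiagramData.nextCorner]
          dsimp only at h1
          omega
        simp only [g, if_pos hd, if_pos h3]
        congr 1
        have h4 : (d.1, d.2 + 1) = smoothing ∅ d := by
          obtain ⟨c, k⟩ := d
          fin_cases k <;> simp_all [smoothing, smoothEnd]
        rw [DiagramData.nextCorner, circleAt_arc, h4, circleAt_smoothing]
      · have h3 : ¬ ((D.nextCorner d).2 : ℕ) % 2 = 0 := by
          simp only [DiagramData.nextCorner]
          dsimp only at h1
          omega
        simp only [g, if_neg hd, if_neg h3]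
    let g' : D.Face → Option (D.Circle ∅) := Quot.lift g (by rintro d _ rfl; exact (hg d).symm)
    have := congrArg g' hf
    change g a = g b at this
    simp only [g, if_pos a.2, if_pos b.2] at this
    exact Option.some_injective _ this
  · cases congrArg Subtype.val h
  · cases congrArg Subtype.val h
  · have := Sum.inr_injective (congrArg Subtype.val h)
    rw [this]

/-- The circles after changing a marker, when this merges two circles. -/
lemma circleOf_eq_iff_of_mul_swap {s t : Finset X} {c : X}
    (h : circlePerm hD t = circlePerm hD s * Equiv.swap (endZero c) (endTwo c))
    (hne : D.circleOf s (Sum.inl (endZero c)) ≠ D.circleOf s (Sum.inl (endTwo c)))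
    (w w' : Place X L) :
    D.circleOf t w = D.circleOf t w' ↔ D.circleOf s w = D.circleOf s w' ∨
      ((D.circleOf s w = D.circleOf s (Sum.inl (endZero c)) ∨
          D.circleOf s w = D.circleOf s (Sum.inl (endTwo c))) ∧
        (D.circleOf s w' = D.circleOf s (Sum.inl (endZero c)) ∨
          D.circleOf s w' = D.circleOf s (Sum.inl (endTwo c)))) := by
  rcases w with a | l <;> rcases w' with b | l'
  · simp only [circleOf, circleAt_eq_iff hD, ne_eq] at hne ⊢
    exact Equiv.Perm.sameCycle_mul_swap_iff h hne a b
  · simp [circleOf, circleAt]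
  · simp [circleOf, circleAt]
  · simp [circleOf, circleAt]

/-- A transposition of two points of one cycle splits it. -/
lemma circleOf_ne_of_eq {s t : Finset X} {c : X} (hc : c ∉ s) (ht : t = insert c s)
    (h : D.circleOf s (Sum.inl (endZero c)) = D.circleOf s (Sum.inl (endTwo c))) :
    D.circleOf t (Sum.inl (endZero c)) ≠ D.circleOf t (Sum.inl (endTwo c)) := by
  simp only [circleOf, circleAt_eq_iff hD, ne_eq] at h ⊢
  exact h.not_sameCycle_mul_swap (endZero_ne_endTwo c) (circlePerm_insert hD hc ht)

/-- The component of the spanning subgraph to which a circle belongs. -/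
noncomputable def circleComponent (s : Finset X) (C : D.Circle s) :
    D.taitGraph.SpanningComponent s :=
  D.componentAt s (Function.surjInv (circleOf_surjective hD s) C)

@[simp]
lemma circleComponent_circleOf (s : Finset X) (w : Place X L) :
    circleComponent hD s (D.circleOf s w) = D.componentAt s w :=
  componentAt_eq_of_circleOf_eq hD s (Function.surjInv_eq _ _)

lemma circleComponent_surjective (s : Finset X) : Function.Surjective (circleComponent hD s) := by
  intro c
  obtain ⟨w, rfl⟩ := D.componentAt_surjective s c
  exact ⟨D.circleOf s w, circleComponent_circleOf hD s w⟩

/-- The circles of a smoothing along a spanning forest are the components of the forest. -/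
lemma circleComponent_injective {s : Finset X} (hs : (s.card : ℕ∞) < D.taitGraph.girth) :
    Function.Injective (circleComponent hD s) := by
  suffices H : ∀ w w', D.componentAt s w = D.componentAt s w' →
      D.circleOf s w = D.circleOf s w' by
    intro C C' h
    obtain ⟨w, rfl⟩ := circleOf_surjective hD s C
    obtain ⟨w', rfl⟩ := circleOf_surjective hD s C'
    rw [circleComponent_circleOf, circleComponent_circleOf] at h
    exact H w w' h
  induction s using Finset.induction_on with
  | empty =>
    intro w w' h
    exact circleOf_empty_eq hD (Graph.spanningComponent_empty_injective h)
  | insert c s hc ih =>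
    rw [Finset.card_insert_of_notMem hc] at hs
    have ih' := ih (lt_of_le_of_lt (by exact_mod_cast Nat.le_succ _) hs)
    -- Below the girth the new edge joins different components, hence different circles, and the
    -- merging rules on both sides coincide.
    have hne := Graph.spanningComponent_ne_of_card_lt_girth hc (D.isLink_vertexAt c)
      (by exact_mod_cast hs)
    have hne' : D.circleOf s (Sum.inl (endZero c)) ≠ D.circleOf s (Sum.inl (endTwo c)) :=
      fun h => hne (componentAt_eq_of_circleOf_eq hD s h)
    intro w w' h
    rw [circleOf_eq_iff_of_mul_swap hD (circlePerm_insert hD hc rfl) hne']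
    have := (Graph.spanningComponent_insert_eq_iff (D.isLink_vertexAt c) rfl _ _).1 h
    exact this.imp (ih' _ _) fun h => ⟨h.1.imp (ih' _ _) (ih' _ _), h.2.imp (ih' _ _) (ih' _ _)⟩

lemma circleComponent_bijective {s : Finset X} (hs : (s.card : ℕ∞) < D.taitGraph.girth) :
    Function.Bijective (circleComponent hD s) :=
  ⟨circleComponent_injective hD hs, circleComponent_surjective hD s⟩

/-- Changing a marker at an edge that joins a component of a forest to itself splits a circle. -/
lemma isMerge_circleComponent {s t : Finset X} {c : X} (hs : (s.card : ℕ∞) < D.taitGraph.girth)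
    (hc : c ∉ s) (ht : t = insert c s)
    (h : D.componentAt s (Sum.inl (endZero c)) = D.componentAt s (Sum.inl (endTwo c))) :
    IsMerge (circleComponent hD t) (D.circleOf t (Sum.inl (endZero c)))
      (D.circleOf t (Sum.inl (endTwo c))) := by
  have hinj : ∀ w w', D.componentAt s w = D.componentAt s w' ↔
      D.circleOf s w = D.circleOf s w' := fun w w' =>
    ⟨fun h => circleComponent_injective hD hs (by simpa using h),
      componentAt_eq_of_circleOf_eq hD s⟩
  have hne := circleOf_ne_of_eq hD hc ht ((hinj _ _).1 h)
  refine ⟨circleComponent_surjective hD t, hne, ?_⟩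
  intro C C'
  obtain ⟨w, rfl⟩ := circleOf_surjective hD t C
  obtain ⟨w', rfl⟩ := circleOf_surjective hD t C'
  rw [circleComponent_circleOf, circleComponent_circleOf]
  -- Read backwards, from `t` to `s`, the split is a merge, and the circles of `s` are the
  -- components of both `s` and `t`.
  rw [← circleOf_eq_iff_of_mul_swap hD
    (Equiv.Perm.eq_mul_swap_symm (circlePerm_insert hD hc ht)) hne, ← hinj]
  exact Graph.spanningComponent_insert_eq_iff_of_eq (D.isLink_vertexAt c) ht h _ _

end LinkDiagram

/-! ### The Khovanov differential in terms of components -/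

namespace LinkDiagram

variable {X L : Type*} [DecidableEq X] [Finite X] [Finite L] {D : LinkDiagram X L}

namespace EnhancedState

/-- The labels as integers. -/
def intLabel (S : D.EnhancedState) (C : D.Circle S.ones) : ℤ := ((S.label C : ℕ) : ℤ)

lemma intLabel_nonneg (S : D.EnhancedState) (C : D.Circle S.ones) : 0 ≤ S.intLabel C := by
  simp [intLabel]

lemma intLabel_le_one (S : D.EnhancedState) (C : D.Circle S.ones) : S.intLabel C ≤ 1 := by
  have := (S.label C).2
  simp only [intLabel]
  omega

lemma intLabel_eq_iff {S T : D.EnhancedState} {C : D.Circle S.ones}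
    {C' : D.Circle T.ones} : S.intLabel C = T.intLabel C' ↔ S.label C = T.label C' := by
  simp [intLabel, Fin.ext_iff]

lemma p_eq_total (S : D.EnhancedState) : S.p = total fun C => 1 - 2 * S.intLabel C := by
  classical
  let _ := Fintype.ofFinite (D.Circle S.ones)
  rw [p, Nat.card_eq_fintype_card, Nat.card_eq_fintype_card, Fintype.card_subtype,
    Fintype.card_subtype, total_eq_sum, Finset.card_filter, Finset.card_filter]
  push_cast
  rw [← Finset.sum_sub_distrib]
  refine Finset.sum_congr rfl fun C _ => ?_
  simp only [intLabel]
  generalize S.label C = a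
  fin_cases a <;> simp

lemma sigma_eq (S : D.EnhancedState) : S.sigma = (Nat.card X : ℤ) - 2 * S.ones.card := by
  classical
  let _ := Fintype.ofFinite X
  have h1 : Nat.card {c : X // c ∈ S.ones} = S.ones.card := by simp
  have h2 := Fintype.card_subtype_compl fun c => c ∈ S.ones
  have h3 := Fintype.card_subtype_le fun c => c ∈ S.ones
  rw [sigma, h1]
  simp only [Nat.card_eq_fintype_card, Fintype.card_coe] at h1 h2 h3 ⊢
  rw [h2]
  push_cast [Nat.cast_sub h3]
  ring

variable {S T : D.EnhancedState} {c : X} (hD : D.IsAlternating)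
include hD

/-- The differential in terms of places. -/
lemma labelStep_iff_place : LabelStep c S T ↔
    (∀ w : Place X L, D.circleOf S.ones w ≠ D.circleOf S.ones (Sum.inl (endZero c)) →
      D.circleOf S.ones w ≠ D.circleOf S.ones (Sum.inl (endTwo c)) →
      T.intLabel (D.circleOf T.ones w) = S.intLabel (D.circleOf S.ones w)) ∧
    total (fun C => 1 - 2 * T.intLabel C) = total (fun C => 1 - 2 * S.intLabel C) - 1 := by
  rw [LabelStep, p_eq_total, p_eq_total, ← and_assoc]
  refine and_congr_left fun _ => ?_
  -- The smoothing pairs the four ends at `c`, one even end in each pair, so the even ends detect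
  -- every circle passing near `c`.
  have hcorner : ∀ k, D.circleAt S.ones (c, k) = D.circleOf S.ones (Sum.inl (endZero c)) ∨
      D.circleAt S.ones (c, k) = D.circleOf S.ones (Sum.inl (endTwo c)) := by
    have h0 := D.circleAt_smoothing S.ones (c, 0)
    have h2 := D.circleAt_smoothing S.ones (c, 2)
    simp only [smoothing, smoothEnd] at h0 h2
    intro k
    by_cases hc : c ∈ S.ones <;> simp only [hc, if_true, if_false] at h0 h2 <;> fin_cases k
    · exact Or.inl rfl
    · exact Or.inr h2
    · exact Or.inr rfl
    · exact Or.inl h0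
    · exact Or.inl rfl
    · exact Or.inl h0
    · exact Or.inr rfl
    · exact Or.inr h2
  constructor
  · rintro ⟨h1, h2⟩ (d | l) hz ht
    · rw [intLabel_eq_iff]
      refine h1 d fun k => ?_
      rcases hcorner k with h | h <;> rw [h]
      exacts [hz, ht]
    · rw [intLabel_eq_iff]
      exact h2 l
  · intro h
    constructor
    · intro d hd
      obtain ⟨a, ha⟩ := exists_evenEnd_circleAt hD d
      rw [ha, ha, ← intLabel_eq_iff]
      refine h (Sum.inl a) ?_ ?_ <;> simp only [circleOf] <;> rw [← ha]
      exacts [hd 0, hd 2]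
    · intro l
      rw [← intLabel_eq_iff]
      exact h (Sum.inr l) Sum.inr_ne_inl Sum.inr_ne_inl

/-- The labels of a state pushed forward to the components of the spanning subgraph, normalised so
that `1` is added for each circle in excess of one. -/
noncomputable def componentLabel (T : D.EnhancedState)
    (c : D.taitGraph.SpanningComponent T.ones) : ℤ :=
  1 + fiberSum (circleComponent hD T.ones) (fun C => T.intLabel C - 1) c

/-- Each circle contributes its label minus one, which is at most zero. No forest assumption enters,
so the bound also holds after a split. -/
lemma componentLabel_le_one (T : D.EnhancedState) (c : D.taitGraph.SpanningComponent T.ones) :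
    componentLabel hD T c ≤ 1 := by
  have h := fiberSum_nonneg (circleComponent hD T.ones) (f := fun C => -(T.intLabel C - 1))
    (fun C => by have := T.intLabel_le_one C; linarith) c
  rw [fiberSum_neg] at h
  unfold componentLabel
  linarith

lemma componentLabel_circleComponent (hT : (T.ones.card : ℕ∞) < D.taitGraph.girth)
    (C : D.Circle T.ones) :
    componentLabel hD T (circleComponent hD T.ones C) = T.intLabel C := by
  unfold componentLabel
  rw [fiberSum_of_injective (circleComponent_injective hD hT)]
  ring

lemma componentLabel_nonneg (hT : (T.ones.card : ℕ∞) < D.taitGraph.girth)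
    (c : D.taitGraph.SpanningComponent T.ones) : 0 ≤ componentLabel hD T c := by
  obtain ⟨C, rfl⟩ := circleComponent_surjective hD _ c
  rw [componentLabel_circleComponent hD hT]
  exact T.intLabel_nonneg C

/-- The differential on states along forests in terms of components. -/
lemma labelStep_iff (hS : (S.ones.card : ℕ∞) < D.taitGraph.girth) (hc : c ∉ S.ones)
    (h : T.ones = insert c S.ones) (hst : S.ones ⊆ T.ones) :
    LabelStep c S T ↔ componentLabel hD T =
      fiberSum (D.taitGraph.componentMap hst) (componentLabel hD S) := by
  rw [labelStep_iff_place hD]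
  have hbS := circleComponent_bijective hD hS
  have hSlab : ∀ w, S.intLabel (D.circleOf S.ones w) =
      componentLabel hD S (D.componentAt S.ones w) := by
    intro w
    rw [← componentLabel_circleComponent hD hS, circleComponent_circleOf]
  have hcS : ∀ w w', D.circleOf S.ones w = D.circleOf S.ones w' ↔
      D.componentAt S.ones w = D.componentAt S.ones w' := fun w w' =>
    ⟨componentAt_eq_of_circleOf_eq hD _, fun h => hbS.1 (by simpa using h)⟩
  have htotS : total (fun C => 1 - 2 * S.intLabel C) =
      total fun c => 1 - 2 * componentLabel hD S c := by
    rw [← total_comp_of_bijective hbS]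
    simp_rw [componentLabel_circleComponent hD hS]
  -- Either the new edge closes a cycle, so a circle splits and the components stay the same, or it
  -- merges two components and their circles.
  by_cases heq : D.componentAt S.ones (Sum.inl (endZero c)) =
      D.componentAt S.ones (Sum.inl (endTwo c))
  · have hm := isMerge_circleComponent hD hS hc h heq
    have hb := Graph.componentMap_bijective (D.isLink_vertexAt c) h hst heq
    have hcT : ∀ w w', D.componentAt T.ones w = D.componentAt T.ones w' ↔
        D.componentAt S.ones w = D.componentAt S.ones w' := fun w w' =>
      Graph.spanningComponent_insert_eq_iff_of_eq (D.isLink_vertexAt c) h heq _ _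
    set g := fiberSum (D.taitGraph.componentMap hst) (componentLabel hD S) with hg
    have hgS : ∀ w, g (D.componentAt T.ones w) = componentLabel hD S (D.componentAt S.ones w) :=
      fun w => fiberSum_of_injective hb.1 _ (D.componentAt S.ones w)
    have htot : total (fun c => 1 - 2 * componentLabel hD S c) = total fun c => 1 - 2 * g c := by
      rw [← total_comp_of_bijective hb]
      congr 1
      funext c
      rw [hg, fiberSum_of_injective hb.1]
    have hsplit := hm.split_label_iff T.intLabel g
    rw [(circleOf_surjective hD T.ones).forall] at hsplit
    rw [htotS, htot]
    refine Iff.trans ?_ hsplit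
    refine and_congr_left fun _ => forall_congr' fun w => ?_
    rw [circleComponent_circleOf, hgS, hSlab]
    -- The circle through `c` before the split corresponds to the same component as the two after
    -- it, so the untouched places agree.
    have e : (D.circleOf S.ones w ≠ D.circleOf S.ones (Sum.inl (endZero c)) ∧
        D.circleOf S.ones w ≠ D.circleOf S.ones (Sum.inl (endTwo c))) ↔
        (D.circleOf T.ones w ≠ D.circleOf T.ones (Sum.inl (endZero c)) ∧
        D.circleOf T.ones w ≠ D.circleOf T.ones (Sum.inl (endTwo c))) := by
      have h1 := hm.eq_iff (D.circleOf T.ones w) (D.circleOf T.ones (Sum.inl (endZero c)))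
      rw [circleComponent_circleOf, circleComponent_circleOf, hcT] at h1
      simp only [ne_eq, hcS, ← heq, h1]
      tauto
    rw [← and_imp, ← and_imp, e]
  · have hm := Graph.isMerge_componentMap (D.isLink_vertexAt c) h hst heq
    have hne : D.circleOf S.ones (Sum.inl (endZero c)) ≠ D.circleOf S.ones (Sum.inl (endTwo c)) :=
      fun h => heq ((hcS _ _).1 h)
    -- `T` is not assumed to lie below the girth; bijectivity is inherited from `S` since circles
    -- and components merge alike.
    have hbT : Function.Bijective (circleComponent hD T.ones) := by
      refine ⟨?_, circleComponent_surjective hD _⟩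
      intro C C' hCC
      obtain ⟨w, rfl⟩ := circleOf_surjective hD _ C
      obtain ⟨w', rfl⟩ := circleOf_surjective hD _ C'
      rw [circleComponent_circleOf, circleComponent_circleOf] at hCC
      rw [circleOf_eq_iff_of_mul_swap hD (circlePerm_insert hD hc h) hne]
      simp only [hcS]
      exact (Graph.spanningComponent_insert_eq_iff (D.isLink_vertexAt c) h _ _).1 hCC
    have hTc : ∀ C, componentLabel hD T (circleComponent hD T.ones C) = T.intLabel C := by
      intro C
      unfold componentLabel
      rw [fiberSum_of_injective hbT.1]
      ring
    have hTlab : ∀ w, T.intLabel (D.circleOf T.ones w) =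
        componentLabel hD T (D.componentAt T.ones w) := by
      intro w
      rw [← hTc, circleComponent_circleOf]
    have htotT : total (fun C => 1 - 2 * T.intLabel C) =
        total fun c => 1 - 2 * componentLabel hD T c := by
      rw [← total_comp_of_bijective hbT]
      simp_rw [hTc]
    have hmerge := hm.merge_label_iff (componentLabel hD S) (componentLabel hD T)
    rw [(D.componentAt_surjective S.ones).forall] at hmerge
    rw [htotS, htotT]
    refine Iff.trans ?_ hmerge
    refine and_congr_left fun _ => forall_congr' fun w => ?_
    rw [hTlab, hSlab, ne_eq, ne_eq, hcS, hcS]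
    rfl

end EnhancedState

/-! #### The two complexes -/

/-- The enhanced Kauffman state of an enhanced state of the Tait graph: each circle gets the label
of its component. -/
noncomputable def kauffmanState (hD : D.IsAlternating) (S : D.taitGraph.EnhancedState) :
    D.EnhancedState where
  ones := S.edges
  label C := S.label (circleComponent hD S.edges C)

variable (hD : D.IsAlternating)
include hD

lemma componentLabel_kauffmanState {S : D.taitGraph.EnhancedState}
    (hS : (S.edges.card : ℕ∞) < D.taitGraph.girth) :
    EnhancedState.componentLabel hD (kauffmanState hD S) = S.intLabel := by
  funext c
  obtain ⟨C, rfl⟩ := circleComponent_surjective hD _ c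
  exact EnhancedState.componentLabel_circleComponent hD (T := kauffmanState hD S) hS C

lemma kauffmanState_injective : Function.Injective (kauffmanState hD) := by
  rintro ⟨s, hs, l⟩ ⟨t, ht, m⟩ h
  have h1 : s = t := congrArg EnhancedState.ones h
  subst h1
  simp only [kauffmanState, EnhancedState.mk.injEq, heq_eq_eq, true_and] at h
  congr 1
  funext c
  obtain ⟨C, rfl⟩ := circleComponent_surjective hD _ c
  exact congrFun h C

lemma exists_kauffmanState_eq (T : D.EnhancedState)
    (hT : (T.ones.card : ℕ∞) < D.taitGraph.girth) : ∃ S, kauffmanState hD S = T := by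
  obtain ⟨s, l⟩ := T
  refine ⟨⟨s, fun _ _ => trivial, fun c =>
    l (Function.surjInv (circleComponent_surjective hD s) c)⟩, ?_⟩
  simp only [kauffmanState, EnhancedState.mk.injEq, heq_eq_eq, true_and]
  funext C
  congr 1
  exact circleComponent_injective hD hT (Function.surjInv_eq _ _)

/-- Below the girth `componentLabel` recovers the graph labels, so both steps are literally the same
fibre-sum equation. -/
lemma labelStep_kauffmanState_iff {S T : D.taitGraph.EnhancedState}
    (hT : (T.edges.card : ℕ∞) < D.taitGraph.girth) {e : X} (he : e ∉ S.edges)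
    (h : T.edges = insert e S.edges) :
    EnhancedState.LabelStep e (kauffmanState hD S) (kauffmanState hD T) ↔
      Graph.EnhancedState.LabelStep e S T := by
  have hst : S.edges ⊆ T.edges := by rw [h]; exact Finset.subset_insert _ _
  have hS : (S.edges.card : ℕ∞) < D.taitGraph.girth :=
    lt_of_le_of_lt (by exact_mod_cast Finset.card_le_card hst) hT
  rw [EnhancedState.labelStep_iff hD (S := kauffmanState hD S) (T := kauffmanState hD T) hS he h
    hst, Graph.EnhancedState.labelStep_iff h hst, componentLabel_kauffmanState hD hT,
    componentLabel_kauffmanState hD hS]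
  rfl

end LinkDiagram

/-! ### The square of the differential -/

namespace Graph.EnhancedState

variable {α β : Type*} [Finite α] {G : Graph α β}

lemma coeff_eq_cubeCoeff [LinearOrder β] (S T : G.EnhancedState) :
    coeff S T = cubeCoeff edges LabelStep S T := rfl

variable [DecidableEq β]

/-- The fibre sum determines every label of the target. -/
lemma labelStep_unique {S T T' : G.EnhancedState} {e : β}
    (h : T.edges = insert e S.edges) (h' : T'.edges = insert e S.edges)
    (hT : LabelStep e S T) (hT' : LabelStep e S T') : T = T' := by
  obtain ⟨s, hs, l⟩ := T
  obtain ⟨t, ht, m⟩ := T'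
  dsimp only at h h'
  subst h h'
  rw [labelStep_iff rfl (Finset.subset_insert _ _)] at hT hT'
  congr 1
  funext c
  exact intLabel_eq_iff.1 (congrFun (hT.trans hT'.symm) c)

lemma degree_eq_of_labelStep {S T : G.EnhancedState} {e : β}
    (h : T.edges = insert e S.edges) (hT : LabelStep e S T) : T.degree = S.degree := by
  have hst : S.edges ⊆ T.edges := by rw [h]; exact Finset.subset_insert _ _
  rw [labelStep_iff h hst] at hT
  have := congrArg total hT
  rw [total_fiberSum, ← degree_eq_total, ← degree_eq_total] at this
  exact_mod_cast this

lemma fiberSum_componentMap_fiberSum {s t w : Finset β} (hst : s ⊆ t) (htw : t ⊆ w)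
    (f : G.SpanningComponent s → ℤ) :
    fiberSum (G.componentMap htw) (fiberSum (G.componentMap hst) f) =
      fiberSum (G.componentMap (hst.trans htw)) f := by
  rw [fiberSum_comp]
  congr 1
  funext c
  exact componentMap_componentMap hst htw c

/-- A pushforward of labels can be factored through an intermediate set of edges. -/
lemma exists_intermediate {s t w : Finset β} (ht : (t : Set β) ⊆ G.edgeSet) (hst : s ⊆ t)
    (htw : t ⊆ w) {f : G.SpanningComponent s → ℤ} {g : G.SpanningComponent w → ℤ}
    (hf : ∀ c, 0 ≤ f c) (hg : ∀ c, g c ≤ 1)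
    (hgf : g = fiberSum (G.componentMap (hst.trans htw)) f) :
    ∃ l : G.SpanningComponent t → Fin 2,
      (EnhancedState.mk t ht l).intLabel = fiberSum (G.componentMap hst) f ∧
      g = fiberSum (G.componentMap htw) (EnhancedState.mk t ht l).intLabel := by
  set m := fiberSum (G.componentMap hst) f with hm
  have hgm : g = fiberSum (G.componentMap htw) m := by
    rw [hm, fiberSum_componentMap_fiberSum, hgf]
  have h0 : ∀ c, 0 ≤ m c := fun c => fiberSum_nonneg _ hf c
  -- All summands are nonnegative, so an intermediate label is bounded by the final one above it;
  -- thus it is a genuine exponent `0` or `1`.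
  have h1 : ∀ c, m c ≤ 1 := by
    intro c
    have := le_fiberSum (G.componentMap htw) h0 c
    rw [← hgm] at this
    exact this.trans (hg _)
  have hl : (EnhancedState.mk t ht fun c => if m c = 0 then 0 else 1).intLabel = m := by
    funext c
    have h0 := h0 c
    have h1 := h1 c
    simp only [intLabel]
    split_ifs with h
    · simp [h]
    · simp only [Fin.val_one, Nat.cast_one]
      omega
  exact ⟨_, hl, by rw [hl, hgm]⟩

end Graph.EnhancedState

namespace Graph.EnhancedState

variable {α β : Type*} [Finite α] [Finite β] [LinearOrder β] {G : Graph α β}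

lemma total_coeff_mul_coeff (i j : ℤ) (S T : G.EnhancedState) (hS : S.IsIn (i - 1) j) :
    total (fun M : {M : G.EnhancedState // M.IsIn i j} => coeff S M * coeff M T) = 0 := by
  simp only [coeff_eq_cubeCoeff]
  refine total_cubeCoeff_mul_eq_zero S T ?_ ?_ ?_
  · intro e M he h hM
    refine ⟨?_, ?_⟩
    · rw [h, Finset.card_insert_of_notMem he]
      push_cast
      linarith [hS.1]
    · rw [degree_eq_of_labelStep h hM]
      exact hS.2
  · intro e M M' _ h h' hM hM'
    exact labelStep_unique h h' hM hM'
  · intro e f M he hf hef h hT hM hMT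
    have h1 : S.edges ⊆ M.edges := by rw [h]; exact Finset.subset_insert _ _
    have h2 : M.edges ⊆ T.edges := by rw [hT]; exact Finset.subset_insert _ _
    have h3 : T.edges = insert e (insert f S.edges) := by rw [hT, h, Finset.insert_comm]
    have h4 : insert f S.edges ⊆ T.edges := by rw [h3]; exact Finset.subset_insert _ _
    rw [labelStep_iff h h1] at hM
    rw [labelStep_iff hT h2, hM, fiberSum_componentMap_fiberSum] at hMT
    obtain ⟨l, hl, hl'⟩ := exists_intermediate
      ((Finset.coe_subset.2 h4).trans T.edges_subset) (Finset.subset_insert f S.edges) h4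
      S.intLabel_nonneg T.intLabel_le_one hMT
    exact ⟨⟨insert f S.edges, _, l⟩, rfl, h3,
      (labelStep_iff rfl (Finset.subset_insert f S.edges)).2 hl,
      (labelStep_iff h3 h4).2 hl'⟩

end Graph.EnhancedState

namespace LinkDiagram

variable {X L : Type*} [LinearOrder X] [Finite X] [Finite L] {D : LinkDiagram X L}

lemma EnhancedState.coeff_eq_cubeCoeff (S T : D.EnhancedState) :
    coeff S T = cubeCoeff ones LabelStep S T := rfl

variable (hD : D.IsAlternating)
include hD

/-- The bound makes `S` and every intermediate state a forest, while `T` may contain a cycle.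
Intermediate labels exist because those of `S` are nonnegative and `componentLabel` of `T` is at
most one. -/
lemma EnhancedState.total_coeff_mul_coeff (p q : ℤ) (S T : D.EnhancedState)
    (hSg : (S.ones.card : ℕ∞) + 1 < D.taitGraph.girth) (hS : S.p = p + 1 ∧ S.q = q) :
    total (fun M : {M : D.EnhancedState // M.p = p ∧ M.q = q} => coeff S M * coeff M T) = 0 := by
  have hforest : ∀ (e : X) (M : D.EnhancedState), e ∉ S.ones → M.ones = insert e S.ones →
      (M.ones.card : ℕ∞) < D.taitGraph.girth := by
    intro e M he h
    rw [h, Finset.card_insert_of_notMem he]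
    exact_mod_cast hSg
  have hS' : (S.ones.card : ℕ∞) < D.taitGraph.girth :=
    lt_of_le_of_lt (by exact_mod_cast Nat.le_succ _) hSg
  simp only [coeff_eq_cubeCoeff]
  refine total_cubeCoeff_mul_eq_zero S T ?_ ?_ ?_
  · intro e M he h hM
    have hp : M.p = S.p - 1 := hM.2.2
    have h1 := S.sigma_eq
    have h2 := M.sigma_eq
    rw [h, Finset.card_insert_of_notMem he] at h2
    push_cast at h2
    have h3 : S.q = S.sigma - 2 * S.p := rfl
    have h4 : M.q = M.sigma - 2 * M.p := rfl
    omega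
  · intro e M M' he h h' hM hM'
    obtain ⟨S, rfl⟩ := exists_kauffmanState_eq hD S hS'
    have hMf := hforest e M he h
    have hMf' := hforest e M' he h'
    obtain ⟨M, rfl⟩ := exists_kauffmanState_eq hD M hMf
    obtain ⟨M', rfl⟩ := exists_kauffmanState_eq hD M' hMf'
    rw [labelStep_kauffmanState_iff hD hMf he h] at hM
    rw [labelStep_kauffmanState_iff hD hMf' he h'] at hM'
    rw [Graph.EnhancedState.labelStep_unique h h' hM hM']
  · intro e f M he hf hef h hT hM hMT
    have h1 : S.ones ⊆ M.ones := by rw [h]; exact Finset.subset_insert _ _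
    have h2 : M.ones ⊆ T.ones := by rw [hT]; exact Finset.subset_insert _ _
    have h3 : T.ones = insert e (insert f S.ones) := by rw [hT, h, Finset.insert_comm]
    have h4 : insert f S.ones ⊆ T.ones := by rw [h3]; exact Finset.subset_insert _ _
    have hfM : f ∉ M.ones := by rw [h]; simp [hf, hef.symm]
    have hef' : e ∉ insert f S.ones := by simp [he, hef]
    rw [labelStep_iff hD hS' he h h1] at hM
    rw [labelStep_iff hD (hforest e M he h) hfM hT h2, hM,
      Graph.EnhancedState.fiberSum_componentMap_fiberSum] at hMT
    obtain ⟨l, hl, hl'⟩ := Graph.EnhancedState.exists_intermediate (G := D.taitGraph)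
      (fun _ _ => trivial) (Finset.subset_insert f S.ones) h4
      (componentLabel_nonneg hD hS') (componentLabel_le_one hD T) hMT
    let N : D.taitGraph.EnhancedState := ⟨insert f S.ones, fun _ _ => trivial, l⟩
    have hN : ((kauffmanState hD N).ones.card : ℕ∞) < D.taitGraph.girth :=
      hforest f (kauffmanState hD N) hf rfl
    have hNl : componentLabel hD (kauffmanState hD N) = N.intLabel :=
      componentLabel_kauffmanState hD hN
    refine ⟨kauffmanState hD N, rfl, h3, ?_, ?_⟩
    · refine (labelStep_iff hD hS' hf rfl (Finset.subset_insert f S.ones)).2 ?_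
      rw [hNl]
      exact hl
    · refine (labelStep_iff hD hN hef' h3 h4).2 ?_
      rw [hNl]
      exact hl'

/-! ### Comparison of the gradings -/

lemma coeff_kauffmanState (S T : D.taitGraph.EnhancedState)
    (hT : (T.edges.card : ℕ∞) < D.taitGraph.girth) :
    EnhancedState.coeff (kauffmanState hD S) (kauffmanState hD T) =
      Graph.EnhancedState.coeff S T := by
  rw [EnhancedState.coeff_eq_cubeCoeff, Graph.EnhancedState.coeff_eq_cubeCoeff]
  exact cubeCoeff_eq_of_iff rfl rfl fun e he h => labelStep_kauffmanState_iff hD hT he h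

lemma p_kauffmanState (S : D.taitGraph.EnhancedState)
    (hS : (S.edges.card : ℕ∞) < D.taitGraph.girth) :
    (kauffmanState hD S).p =
      D.taitGraph.vertexSet.ncard - S.edges.card - 2 * S.degree := by
  rw [EnhancedState.p_eq_total, Graph.EnhancedState.degree_eq_total,
    ← Graph.card_spanningComponent S.edges_subset hS, ← total_one, ← total_mul_left, ← total_sub]
  exact total_comp_of_bijective (circleComponent_bijective hD hS) fun c => 1 - 2 * S.intLabel c

/-- The identity `σ = q + 2p = E - 2i` recovers the number of edges, and then `p` recovers the
degree. -/
lemma kauffmanState_grading_iff (S : D.taitGraph.EnhancedState)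
    (hS : (S.edges.card : ℕ∞) < D.taitGraph.girth) (i j : ℤ) :
    ((kauffmanState hD S).p = D.taitGraph.vertexSet.ncard - i - 2 * j ∧
      (kauffmanState hD S).q =
        D.taitGraph.edgeSet.ncard - 2 * D.taitGraph.vertexSet.ncard + 4 * j) ↔ S.IsIn i j := by
  have h1 := p_kauffmanState hD S hS
  have h2 := (kauffmanState hD S).sigma_eq
  have h3 : (kauffmanState hD S).q = (kauffmanState hD S).sigma - 2 * (kauffmanState hD S).p := rfl
  have h4 : (kauffmanState hD S).ones = S.edges := rfl
  have h5 : D.taitGraph.edgeSet.ncard = Nat.card X := Set.ncard_univ X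
  rw [h4] at h2
  rw [h5, h3, Graph.EnhancedState.IsIn]
  omega

lemma card_ones_of_grading (T : D.EnhancedState) {i j : ℤ}
    (h : T.p = D.taitGraph.vertexSet.ncard - i - 2 * j ∧
      T.q = D.taitGraph.edgeSet.ncard - 2 * D.taitGraph.vertexSet.ncard + 4 * j) :
    (T.ones.card : ℤ) = i := by
  have h2 := T.sigma_eq
  have h3 : T.q = T.sigma - 2 * T.p := rfl
  have h5 : D.taitGraph.edgeSet.ncard = Nat.card X := Set.ncard_univ X
  rw [h5] at h
  omega

/-- Below the girth, the enhanced states of the Tait graph correspond to those of the diagram. -/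
lemma exists_equiv_kauffmanState {i j : ℤ}
    (hi : ∀ n : ℕ, (n : ℤ) = i → (n : ℕ∞) < D.taitGraph.girth) {P : D.EnhancedState → Prop}
    (hP : ∀ T : D.EnhancedState, P T ↔ T.p = D.taitGraph.vertexSet.ncard - i - 2 * j ∧
      T.q = D.taitGraph.edgeSet.ncard - 2 * D.taitGraph.vertexSet.ncard + 4 * j) :
    ∃ e : {S : D.taitGraph.EnhancedState // S.IsIn i j} ≃ {T : D.EnhancedState // P T},
      ∀ S, (e S : D.EnhancedState) = kauffmanState hD S := by
  refine ⟨Equiv.ofBijective (fun S => ⟨kauffmanState hD S, (hP _).2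
    ((kauffmanState_grading_iff hD S.1 (hi _ S.2.1) i j).2 S.2)⟩) ⟨?_, ?_⟩, fun S => rfl⟩
  · intro S T h
    exact Subtype.ext (kauffmanState_injective hD (congrArg Subtype.val h))
  · rintro ⟨T, hT⟩
    have hT' := (hP T).1 hT
    have hg := hi _ (card_ones_of_grading hD T hT')
    obtain ⟨S, rfl⟩ := exists_kauffmanState_eq hD T hg
    exact ⟨⟨S, (kauffmanState_grading_iff hD S hg i j).1 hT'⟩, rfl⟩

/-- Comparison of the homology groups when all states involved lie below the girth. -/
lemma nonempty_cohomology_equiv {i j : ℤ}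
    (hi : ∀ n : ℕ, (n : ℤ) ≤ i + 1 → (n : ℕ∞) < D.taitGraph.girth)
    {P Q R : D.EnhancedState → Prop}
    (hP : ∀ T : D.EnhancedState, P T ↔ T.p = D.taitGraph.vertexSet.ncard - (i - 1) - 2 * j ∧
      T.q = D.taitGraph.edgeSet.ncard - 2 * D.taitGraph.vertexSet.ncard + 4 * j)
    (hQ : ∀ T : D.EnhancedState, Q T ↔ T.p = D.taitGraph.vertexSet.ncard - i - 2 * j ∧
      T.q = D.taitGraph.edgeSet.ncard - 2 * D.taitGraph.vertexSet.ncard + 4 * j)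
    (hR : ∀ T : D.EnhancedState, R T ↔ T.p = D.taitGraph.vertexSet.ncard - (i + 1) - 2 * j ∧
      T.q = D.taitGraph.edgeSet.ncard - 2 * D.taitGraph.vertexSet.ncard + 4 * j) :
    Nonempty (D.taitGraph.Cohomology i j ≃+
      StateHomology (EnhancedState.coeff (D := D)) P Q R) := by
  -- If `i - 1` is negative, the girth condition is vacuous and both sets of states are empty.
  obtain ⟨eP, heP⟩ := exists_equiv_kauffmanState hD (fun n hn => hi n (by omega)) hP
  obtain ⟨eQ, heQ⟩ := exists_equiv_kauffmanState hD (fun n hn => hi n (by omega)) hQ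
  obtain ⟨eR, heR⟩ := exists_equiv_kauffmanState hD (fun n hn => hi n (by omega)) hR
  obtain ⟨e⟩ := nonempty_stateHomology_equiv (inc := EnhancedState.coeff (D := D))
    (inc' := Graph.EnhancedState.coeff (G := D.taitGraph)) eP eQ eR
    (fun S T => by
      rw [heP, heQ]
      exact coeff_kauffmanState hD _ _ (hi _ (by have := T.2.1; omega)))
    (fun S T => by
      rw [heQ, heR]
      exact coeff_kauffmanState hD _ _ (hi _ (by have := T.2.1; omega)))
  exact ⟨e.symm⟩

/-- Comparison of the torsion of the homology groups one degree below the girth. -/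
lemma nonempty_torsion_cohomology_equiv {i j : ℤ}
    (hi : ∀ n : ℕ, (n : ℤ) ≤ i → (n : ℕ∞) < D.taitGraph.girth) :
    Nonempty (AddCommGroup.torsion (D.taitGraph.Cohomology i j) ≃+
      AddCommGroup.torsion (D.Homology (D.taitGraph.vertexSet.ncard - i - 2 * j)
        (D.taitGraph.edgeSet.ncard - 2 * D.taitGraph.vertexSet.ncard + 4 * j))) := by
  have hP : ∀ T : D.EnhancedState, (T.p = D.taitGraph.vertexSet.ncard - i - 2 * j + 1 ∧
      T.q = D.taitGraph.edgeSet.ncard - 2 * D.taitGraph.vertexSet.ncard + 4 * j) ↔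
      (T.p = D.taitGraph.vertexSet.ncard - (i - 1) - 2 * j ∧
        T.q = D.taitGraph.edgeSet.ncard - 2 * D.taitGraph.vertexSet.ncard + 4 * j) := by
    intro T
    omega
  obtain ⟨eP, heP⟩ := exists_equiv_kauffmanState hD (fun n hn => hi n (by omega)) hP
  obtain ⟨eQ, heQ⟩ := exists_equiv_kauffmanState hD (i := i) (j := j)
    (fun n hn => hi n (by omega)) (fun _ => Iff.rfl)
  obtain ⟨e⟩ := nonempty_torsion_stateHomology_equiv (inc := EnhancedState.coeff (D := D))
    (inc' := Graph.EnhancedState.coeff (G := D.taitGraph)) eP eQ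
    (R := fun T => T.p = D.taitGraph.vertexSet.ncard - i - 2 * j - 1 ∧
      T.q = D.taitGraph.edgeSet.ncard - 2 * D.taitGraph.vertexSet.ncard + 4 * j)
    (R' := Graph.EnhancedState.IsIn (i + 1) j)
    (fun S T => by
      rw [heP, heQ]
      exact coeff_kauffmanState hD _ _ (hi _ (by have := T.2.1; omega)))
    (fun S T hS _ => by
      have hc := card_ones_of_grading hD S ((hP S).1 hS)
      -- `S` has `i - 1` edges, so its one-edge extensions have `i` and still lie below the girth.
      exact EnhancedState.total_coeff_mul_coeff hD _ _ S T
        (by exact_mod_cast hi (S.ones.card + 1) (by push_cast; omega)) hS)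
    (fun S T hS _ => Graph.EnhancedState.total_coeff_mul_coeff i j S T hS)
  exact ⟨e.symm⟩

end LinkDiagram

theorem mainTheorem10 {X L : Type*} [LinearOrder X] [Finite X] [Finite L]
    (D : LinkDiagram X L) (hD : D.IsAlternating) (V E : ℤ)
    (hV : V = D.taitGraph.vertexSet.ncard) (hE : E = D.taitGraph.edgeSet.ncard) (i j : ℕ) :
    ((i : ℕ∞) + 1 < D.taitGraph.girth →
      Nonempty (D.taitGraph.Cohomology i j ≃+ D.Homology (V - i - 2 * j) (E - 2 * V + 4 * j)) ∧
      Nonempty (D.taitGraph.Cohomology i j ≃+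
        D.SigmaHomology (E - 2 * i) (E - 2 * V + 4 * j))) ∧
    ((i : ℕ∞) + 1 = D.taitGraph.girth →
      Nonempty (AddCommGroup.torsion (D.taitGraph.Cohomology i j) ≃+
        AddCommGroup.torsion (D.Homology (V - i - 2 * j) (E - 2 * V + 4 * j)))) := by
  subst hV hE
  refine ⟨fun h => ?_, fun h => ?_⟩
  · have hi : ∀ n : ℕ, (n : ℤ) ≤ i + 1 → (n : ℕ∞) < D.taitGraph.girth := fun n hn =>
      lt_of_le_of_lt (by exact_mod_cast hn) h
    have hq : ∀ T : D.EnhancedState, T.q = T.sigma - 2 * T.p := fun _ => rfl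
    constructor
    · refine LinkDiagram.nonempty_cohomology_equiv hD hi ?_ ?_ ?_ <;> intro T <;> omega
    -- At fixed `q`, the relation `σ = q + 2p` turns `σ = E - 2i` into `p = V - i - 2j`, and a step
    -- of `2` in `σ` into a step of `1` in `p`.
    · refine LinkDiagram.nonempty_cohomology_equiv hD hi ?_ ?_ ?_ <;> intro T <;>
        have := hq T <;> omega
  · refine LinkDiagram.nonempty_torsion_cohomology_equiv hD fun n hn => ?_
    rw [← h]
    exact_mod_cast Nat.lt_succ_of_le (by exact_mod_cast hn)
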